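/- Conventions. A link is given by an oriented link diagram with finitely many classical crossings (the empty diagram and crossing-free circles are allowed, and so are virtual crossings, so that classical and virtual links are both covered). It is recorded by its edges (semi-arcs) and by the sign and the incoming and outgoing over- and under-edges of each crossing. Two diagrams represent the same link if they are connected by a finite sequence of oriented Reidemeister moves I, II, III (all oriented versions). A quandle is a set with a binary operation $\triangleright$ such that $a\triangleright a=a$, every map $x\mapsto x\triangleright b$ is bijective, and $(a\triangleright b)\triangleright c=(a\triangleright c)\triangleright(b\triangleright c)$; $x\triangleright^{n}y$ $(n\in\mathbb Z)$ denotes the $n$-th power of the permutation $-\triangleright y$ applied to $x$. The knot quandle $Q(L)$ has one generator for each arc of a diagram of $L$ and one relation for each crossing: if the under-strand changes from $x$ to $z$ under the over-arc $y$, then $z=x\triangleright y$ at a positive and $z=x\triangleright^{-1}y$ at a negative crossing. A biquandle is a set $B$ with four binary operations $a^b,\ a^{\overline b},\ a_b,\ a_{\overline b}$ such that (with $a^{bc}=(a^b)^c$, $c_{ba}=(c_b)_a$, etc.), for all $a,b,c\in B$: 1. $a=a^{b\overline{b_a}}$, $b=b_{a\overline{a^b}}$, $a=a^{\overline b b_{\overline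 a}}$, $b=b_{\overline a a^{\overline b}}$; 2. there are $x,y\in B$ with $x=a^{b_{\overline x}}$, $a=x^{\overline b}$, $b=b_{\overline x a}$, and $y=a^{\overline{b_y}}$, $a=y^b$, $b=b_{y\overline a}$; 3. $a^{bc}=a^{c_bb^c}$, $c_{ba}=c_{a^bb_a}$, $(b_a)^{c_{a^b}}=(b^c)_{a^{c_b}}$, and the same three identities hold with every operation replaced by the barred one; 4. there are a unique $x\in B$ with $x=a_x$, $a=x^a$, and a unique $y\in B$ with $y=a^{\overline y}$, $a=y_{\overline a}$. Homomorphisms of biquandles are maps that preserve the four operations. The knot biquandle $B(L)$ is generated by the edges of a diagram of $L$, subject to the biquandle axioms (with the solutions $x,y$ in 2 unique) and the following relations: at a positive crossing with incoming under-edge $a$ and incoming over-edge $b$, the outgoing under-edge is $a^b$ and the outgoing over-edge is $b_a$; at a negative crossing they are $a^{\overline b}$ and $b_{\overline a}$. Polynomials. Let $m,n\in\mathbb Z$. For a finite quandle $T$ and a subquandle $S\subset T$ put \[ sqp_{m,n}(S\subset T)=\sum_{x\in S}s^{r_m(x)}t^{c_n(x)},\qquad r_m(x)=|\{y\in T: x\triangleright^m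 y=x\}|,\quad c_n(x)=|\{y\in T: y\triangleright^n x=y\}|. \] For a finite biquandle $T$ write $\mathrm{op}_1(x,y)=x^{\overline y}$, $\mathrm{op}_2(x,y)=x^y$, $\mathrm{op}_3(x,y)=x_{\overline y}$, $\mathrm{op}_4(x,y)=x_y$. Each $\mathrm{op}_i(-,y)$ is a permutation of $T$; let $\mathrm{op}_i^n(x,y)$ be its $n$-th power at $x$. For a subbiquandle $S\subset T$ put \[ sbp_{m,n}(S\subset T)=\sum_{x\in S}\prod_{i=1}^4 s_i^{r^i_m(x)}t_i^{c^i_n(x)},\qquad r^i_m(x)=|\{y\in T:\mathrm{op}_i^m(x,y)=x\}|,\quad c^i_n(x)=|\{y\in T:\mathrm{op}_i^n(y,x)=y\}|. \] Statement. Let $m,n\in\mathbb Z$. (a) Let $T$ be a finite quandle. The multiset $\Phi_{sqp_{m,n}}(L,T)=\{sqp_{m,n}(\mathrm{Im}(f)\subset T): f\in\mathrm{Hom}(Q(L),T)\}$ and its polynomial form $\phi_{sqp_{m,n}}(L,T)=\sum_{f\in\mathrm{Hom}(Q(L),T)}q^{sqp_{m,n}(\mathrm{Im}(f)\subset T)}$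 (a formal sum of powers of $q$ with polynomial exponents) are invariants of links: diagrams of the same link have the same $\Phi_{sqp_{m,n}}$ and the same $\phi_{sqp_{m,n}}$. They refine the counting invariant: the cardinality of $\Phi_{sqp_{m,n}}(L,T)$, and the value of $\phi_{sqp_{m,n}}(L,T)$ at $q=1$, are both $|\mathrm{Hom}(Q(L),T)|$. (b) Let $T$ be a finite biquandle. The same holds for $\Phi_{sbp_{m,n}}(L,T)=\{sbp_{m,n}(\mathrm{Im}(f)\subset T): f\in\mathrm{Hom}(B(L),T)\}$ and $\phi_{sbp_{m,n}}(L,T)=\sum_{f\in\mathrm{Hom}(B(L),T)}q^{sbp_{m,n}(\mathrm{Im}(f)\subset T)}$: both are invariants of links, and the cardinality of $\Phi_{sbp_{m,n}}(L,T)$ and the value of $\phi_{sbp_{m,n}}(L,T)$ at $q=1$ are both $|\mathrm{Hom}(B(L),T)|$. -/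

import Mathlib

open scoped Quandles

universe u v

namespace LinkPoly

/-! ### Oriented link diagrams and Reidemeister moves -/

/-- A vertex of an oriented link diagram with edges (semi-arcs) named by `A`: a crossing of the given
sign (`true` is a positive crossing), with its incoming and outgoing over-edge and its incoming and
outgoing under-edge; or a marked point subdividing an arc of the link. -/
inductive Vertex (A : Type) : Type
  | crossing (positive : Bool) (overIn overOut underIn underOut : A) : Vertex A
  | point (source target : A) : Vertex A

namespace Vertex

/-- The edges that point into the vertex. -/
def ins {A : Type} : Vertex A → Multiset A
  | crossing _ oi _ ui _ => {oi, ui}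
  | point a _ => {a}

/-- The edges that leave the vertex. -/
def outs {A : Type} : Vertex A → Multiset A
  | crossing _ _ oo _ uo => {oo, uo}
  | point _ b => {b}

/-- Renaming of edges. -/
def map {A B : Type} (g : A → B) : Vertex A → Vertex B
  | crossing p oi oo ui uo => crossing p (g oi) (g oo) (g ui) (g uo)
  | point a b => point (g a) (g b)

end Vertex

/-- An oriented link diagram, recorded combinatorially: finitely many crossings and marked points joined
by edges, where every edge leaves exactly one vertex and enters exactly one vertex. A component without
crossings is a circle carrying at least one marked point. Planarity is not required: a code that is not
planar is a diagram with virtual crossings (which are not recorded), and the planar codes are the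
diagrams of classical links. -/
structure Diagram : Type where
  verts : Multiset (Vertex ℕ)
  nodup_ins : (verts.bind Vertex.ins).Nodup
  ins_eq_outs : verts.bind Vertex.ins = verts.bind Vertex.outs

namespace Diagram

/-- The edges (semi-arcs) of a diagram. -/
def Edge (D : Diagram) : Type := {a : ℕ // a ∈ D.verts.bind Vertex.ins}

instance (D : Diagram) : Finite D.Edge :=
  Finite.of_injective
    (fun a : D.Edge => (⟨a.1, Multiset.mem_toFinset.2 a.2⟩ :
      {a : ℕ // a ∈ (D.verts.bind Vertex.ins).toFinset}))
    (fun _ _ h => Subtype.ext (congrArg (fun c => c.1) h))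

end Diagram

/-- A strand `e0 → e1 → e2` passes two vertices: the edges `(incoming, outgoing)` at the first one
(`first = true`) or at the second one. -/
def leg (first : Bool) (e : Fin 3 → ℕ) : ℕ × ℕ :=
  if first then (e 0, e 1) else (e 1, e 2)

/-- A crossing of sign `p` given by the pairs `(incoming, outgoing)` of its over-strand `o` and its
under-strand `w`. -/
def cross (p : Bool) (o w : ℕ × ℕ) : Vertex ℕ :=
  .crossing p o.1 o.2 w.1 w.2

/-- One side of the third Reidemeister move on a top strand `t`, a middle strand `m` and a bottom strand
`b`. The signs `x`, `y`, `z` of the crossings top/middle, top/bottom and middle/bottom can be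
prescribed; together they determine, up to simultaneous reversal on all three strands, in which order
each strand meets its two crossings. On side `true`, the top strand meets the top/bottom crossing first
iff `x * y * z` is positive, the middle strand meets the middle/bottom crossing first iff `x` is
positive, and the bottom strand meets the middle/bottom crossing first iff `y` is positive. -/
def triangle (side x y z : Bool) (t m b : Fin 3 → ℕ) : Multiset (Vertex ℕ) :=
  let p : Bool := (x == y) == z
  { cross x (leg (side != p) t) (leg (side != x) m),
    cross y (leg (side == p) t) (leg (side != y) b),
    cross z (leg (side == x) m) (leg (side == y) b) }

/-- The elementary moves between oriented link diagrams: renaming the edges, removing a marked point,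
and all oriented versions of the three Reidemeister moves. -/
inductive Move (D D' : Diagram) : Prop
  /-- Rename the edges. -/
  | rename (g : Equiv.Perm ℕ) (h : D'.verts = D.verts.map (Vertex.map g)) : Move D D'
  /-- Remove a marked point between two distinct edges `a` and `b`, which are merged. -/
  | unmark (a b : ℕ) (hab : a ≠ b) (E : Multiset (Vertex ℕ))
      (h : D.verts = .point a b ::ₘ E)
      (h' : D'.verts = E.map (Vertex.map fun c => if c = b then a else c)) : Move D D'
  /-- Remove a kink, of either sign, that passes first over and then under itself. -/
  | kinkOver (p : Bool) (a l b : ℕ) (E : Multiset (Vertex ℕ))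
      (h : D.verts = cross p (a, l) (l, b) ::ₘ E)
      (h' : D'.verts = .point a b ::ₘ E) : Move D D'
  /-- Remove a kink, of either sign, that passes first under and then over itself. -/
  | kinkUnder (p : Bool) (a l b : ℕ) (E : Multiset (Vertex ℕ))
      (h : D.verts = cross p (l, b) (a, l) ::ₘ E)
      (h' : D'.verts = .point a b ::ₘ E) : Move D D'
  /-- Pull apart two parallel strands, `a → e → b` lying over `c → f → d`. -/
  | parallel (p : Bool) (a e b c f d : ℕ) (E : Multiset (Vertex ℕ))
      (h : D.verts = cross p (a, e) (c, f) ::ₘ cross (!p) (e, b) (f, d) ::ₘ E)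
      (h' : D'.verts = .point a b ::ₘ .point c d ::ₘ E) : Move D D'
  /-- Pull apart two antiparallel strands, `a → e → b` lying over `c → f → d`. -/
  | antiparallel (p : Bool) (a e b c f d : ℕ) (E : Multiset (Vertex ℕ))
      (h : D.verts = cross p (a, e) (f, d) ::ₘ cross (!p) (e, b) (c, f) ::ₘ E)
      (h' : D'.verts = .point a b ::ₘ .point c d ::ₘ E) : Move D D'
  /-- Slide a strand across a crossing of two other strands. -/
  | slide (x y z : Bool) (t m b : Fin 3 → ℕ) (E : Multiset (Vertex ℕ))
      (h : D.verts = triangle true x y z t m b + E)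
      (h' : D'.verts = triangle false x y z t m b + E) : Move D D'

/-- Two diagrams represent the same oriented link: they are connected by a finite sequence of moves
and inverse moves. -/
def SameLink : Diagram → Diagram → Prop := Relation.EqvGen Move

/-! ### The knot quandle

Mathlib writes the quandle operation on the left: `x ▷ y` is `y ◃ x`, and `x ▷⁻¹ y` is `y ◃⁻¹ x`. -/

/-- Quandle words in the generators `X`; `tri a b` is `a ▷ b` and `triInv a b` is `a ▷⁻¹ b`. -/
inductive QWord (X : Type v) : Type v
  | gen (x : X) : QWord X
  | tri (a b : QWord X) : QWord X
  | triInv (a b : QWord X) : QWord X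

/-- The equivalence of quandle words generated by the quandle axioms and the relations `R`. -/
inductive QWord.Eqv {X : Type v} (R : QWord X → QWord X → Prop) : QWord X → QWord X → Prop
  | rel {a b} : R a b → Eqv R a b
  | refl (a) : Eqv R a a
  | symm {a b} : Eqv R a b → Eqv R b a
  | trans {a b c} : Eqv R a b → Eqv R b c → Eqv R a c
  | tri {a a' b b'} : Eqv R a a' → Eqv R b b' → Eqv R (.tri a b) (.tri a' b')
  | triInv {a a' b b'} : Eqv R a a' → Eqv R b b' → Eqv R (.triInv a b) (.triInv a' b')
  | idem (a) : Eqv R (.tri a a) a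
  | cancel (a b) : Eqv R (.triInv (.tri a b) b) a
  | cancel' (a b) : Eqv R (.tri (.triInv a b) b) a
  | distrib (a b c) : Eqv R (.tri (.tri a b) c) (.tri (.tri a c) (.tri b c))

/-- The setoid of equivalent quandle words. -/
def QWord.setoid {X : Type v} (R : QWord X → QWord X → Prop) : Setoid (QWord X) where
  r := QWord.Eqv R
  iseqv := ⟨.refl, .symm, .trans⟩

/-- The quandle presented by the generators `X` and the relations `R`. -/
def PresentedQuandle {X : Type v} (R : QWord X → QWord X → Prop) : Type v := Quotient (QWord.setoid R)

instance {X : Type v} (R : QWord X → QWord X → Prop) : Quandle (PresentedQuandle R) where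
  act b a := Quotient.map₂ QWord.tri (fun _ _ h _ _ k => QWord.Eqv.tri h k) a b
  self_distrib {c b a} := by
    induction a using Quotient.inductionOn
    induction b using Quotient.inductionOn
    induction c using Quotient.inductionOn
    exact Quotient.sound (.distrib _ _ _)
  invAct b a := Quotient.map₂ QWord.triInv (fun _ _ h _ _ k => QWord.Eqv.triInv h k) a b
  left_inv b a := by
    induction a using Quotient.inductionOn
    induction b using Quotient.inductionOn
    exact Quotient.sound (.cancel _ _)
  right_inv b a := by
    induction a using Quotient.inductionOn
    induction b using Quotient.inductionOn
    exact Quotient.sound (.cancel' _ _)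
  fix {a} := by
    induction a using Quotient.inductionOn
    exact Quotient.sound (.idem _)

/-- The relations of the knot quandle: the over-strand and a marked point do not change the generator,
and passing under `y` changes `x` to `x ▷ y` at a positive and to `x ▷⁻¹ y` at a negative crossing. -/
inductive Diagram.QRel (D : Diagram) : QWord D.Edge → QWord D.Edge → Prop
  | overStrand (p : Bool) (oi oo ui uo : D.Edge) (h : .crossing p oi.1 oo.1 ui.1 uo.1 ∈ D.verts) :
      QRel D (.gen oo) (.gen oi)
  | pos (oi oo ui uo : D.Edge) (h : .crossing true oi.1 oo.1 ui.1 uo.1 ∈ D.verts) :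
      QRel D (.gen uo) (.tri (.gen ui) (.gen oi))
  | neg (oi oo ui uo : D.Edge) (h : .crossing false oi.1 oo.1 ui.1 uo.1 ∈ D.verts) :
      QRel D (.gen uo) (.triInv (.gen ui) (.gen oi))
  | point (a b : D.Edge) (h : .point a.1 b.1 ∈ D.verts) : QRel D (.gen b) (.gen a)

/-- The knot quandle `Q(L)` of the link with diagram `D`. -/
abbrev Diagram.Q (D : Diagram) : Type := PresentedQuandle D.QRel

/-- There are finitely many homomorphisms from the knot quandle to a finite quandle. -/
instance (D : Diagram) (T : Type u) [Quandle T] [Finite T] : Finite (D.Q →◃ T) := by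
  refine Finite.of_injective
    (fun (f : D.Q →◃ T) (x : D.Edge) => f (Quotient.mk (QWord.setoid D.QRel) (.gen x))) ?_
  intro f g h
  ext q
  let mk : QWord D.Edge → D.Q := Quotient.mk (QWord.setoid D.QRel)
  induction q using Quotient.inductionOn with
  | h w =>
    change f (mk w) = g (mk w)
    induction w with
    | gen x => exact congrFun h x
    | tri a b iha ihb =>
      have e : mk (.tri a b) = mk b ◃ mk a := rfl
      rw [e, ShelfHom.map_act, ShelfHom.map_act, iha, ihb]
    | triInv a b iha ihb =>
      have e : mk a = mk b ◃ mk (.triInv a b) := (Quotient.sound (QWord.Eqv.cancel' a b)).symm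
      rw [e, ShelfHom.map_act, ShelfHom.map_act, ihb] at iha
      exact (Rack.left_cancel _).1 iha

/-! ### Subquandle polynomials -/

/-- A subquandle: a subset closed under `▷` and `▷⁻¹`. -/
structure Subquandle (Q : Type u) [Quandle Q] where
  carrier : Set Q
  act_mem : ∀ {a b}, a ∈ carrier → b ∈ carrier → a ◃ b ∈ carrier
  invAct_mem : ∀ {a b}, a ∈ carrier → b ∈ carrier → a ◃⁻¹ b ∈ carrier

/-- The image of a quandle homomorphism. -/
def Subquandle.image {P : Type v} {Q : Type u} [Quandle P] [Quandle Q] (f : P →◃ Q) : Subquandle Q where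
  carrier := Set.range f
  act_mem := by
    rintro _ _ ⟨x, rfl⟩ ⟨y, rfl⟩
    exact ⟨x ◃ y, f.map_act⟩
  invAct_mem := by
    rintro _ _ ⟨x, rfl⟩ ⟨y, rfl⟩
    refine ⟨x ◃⁻¹ y, (Rack.left_cancel (f x)).1 ?_⟩
    rw [← f.map_act, Rack.right_inv, Rack.right_inv]

noncomputable section

/-- `x ▷ⁿ y` for an integer `n`. -/
def triPow {Q : Type u} [Quandle Q] (n : ℤ) (x y : Q) : Q := (Rack.act' y ^ n) x

/-- `r_m(x)` is the number of `y` with `x ▷ᵐ y = x`. -/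
def rowCount {Q : Type u} [Quandle Q] (m : ℤ) (x : Q) : ℕ := {y : Q | triPow m x y = x}.ncard

/-- `c_n(x)` is the number of `y` with `y ▷ⁿ x = y`. -/
def colCount {Q : Type u} [Quandle Q] (n : ℤ) (x : Q) : ℕ := {y : Q | triPow n y x = y}.ncard

/-- The generalized subquandle polynomial of `S ⊂ Q`, in the variables `s = X 0` and `t = X 1`. -/
def sqp {Q : Type u} [Quandle Q] [Finite Q] (m n : ℤ) (S : Subquandle Q) : MvPolynomial (Fin 2) ℤ :=
  ∑ᶠ x ∈ S.carrier, .X 0 ^ rowCount m x * .X 1 ^ colCount n x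

/-- The multiset of values of a function on a finite type. -/
def values {I : Type v} [Finite I] {M : Type u} (F : I → M) : Multiset M :=
  (@Finset.univ I (Fintype.ofFinite I)).val.map F

/-- The sum of the formal powers `q ^ F i` over a finite type, with exponents in an additive monoid. -/
def powerSum {I : Type v} [Finite I] {M : Type u} [AddCommMonoid M] (F : I → M) :
    AddMonoidAlgebra ℤ M :=
  ∑ᶠ i, AddMonoidAlgebra.single (F i) 1

/-- The specialization `q = 1`: the ring homomorphism that sends every `q ^ a` to `1`. -/
def setQOne {M : Type u} [AddCommMonoid M] : AddMonoidAlgebra ℤ M →ₐ[ℤ] ℤ :=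
  AddMonoidAlgebra.lift ℤ ℤ M 1

/-- The subquandle polynomial invariant as a multiset. -/
def PhiSqp (m n : ℤ) (D : Diagram) (T : Type u) [Quandle T] [Finite T] :
    Multiset (MvPolynomial (Fin 2) ℤ) :=
  values fun f : D.Q →◃ T => sqp m n (Subquandle.image f)

/-- The subquandle polynomial invariant in polynomial form. -/
def phiSqp (m n : ℤ) (D : Diagram) (T : Type u) [Quandle T] [Finite T] :
    AddMonoidAlgebra ℤ (MvPolynomial (Fin 2) ℤ) :=
  powerSum fun f : D.Q →◃ T => sqp m n (Subquandle.image f)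

end

/-! ### Biquandles -/

/-- A biquandle: `up a b` is the superscript operation `a ^ b`, `down a b` is the subscript operation
`a _ b`, and `upBar`, `downBar` are the corresponding operations with a barred second argument. -/
class Biquandle (B : Type u) where
  up : B → B → B
  upBar : B → B → B
  down : B → B → B
  downBar : B → B → B
  inv_up : ∀ a b, a = upBar (up a b) (down b a)
  inv_down : ∀ a b, b = downBar (down b a) (up a b)
  inv_upBar : ∀ a b, a = up (upBar a b) (downBar b a)
  inv_downBar : ∀ a b, b = down (downBar b a) (upBar a b)
  exists_bar : ∀ a b, ∃ x, x = up a (downBar b x) ∧ a = upBar x b ∧ b = down (downBar b x) a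
  exists_unbar : ∀ a b, ∃ y, y = upBar a (down b y) ∧ a = up y b ∧ b = downBar (down b y) a
  braid_up : ∀ a b c, up (up a b) c = up (up a (down c b)) (up b c)
  braid_down : ∀ a b c, down (down c b) a = down (down c (up a b)) (down b a)
  braid_mid : ∀ a b c, up (down b a) (down c (up a b)) = down (up b c) (up a (down c b))
  braid_upBar : ∀ a b c, upBar (upBar a b) c = upBar (upBar a (downBar c b)) (upBar b c)
  braid_downBar : ∀ a b c,
    downBar (downBar c b) a = downBar (downBar c (upBar a b)) (downBar b a)
  braid_midBar : ∀ a b c,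
    upBar (downBar b a) (downBar c (upBar a b)) = downBar (upBar b c) (upBar a (downBar c b))
  kink : ∀ a, ∃! x, x = down a x ∧ a = up x a
  kinkBar : ∀ a, ∃! y, y = upBar a y ∧ a = downBar y a

/-- A homomorphism of biquandles. -/
@[ext]
structure BiquandleHom (A : Type v) (B : Type u) [Biquandle A] [Biquandle B] where
  toFun : A → B
  map_up : ∀ a b, toFun (Biquandle.up a b) = Biquandle.up (toFun a) (toFun b)
  map_upBar : ∀ a b, toFun (Biquandle.upBar a b) = Biquandle.upBar (toFun a) (toFun b)
  map_down : ∀ a b, toFun (Biquandle.down a b) = Biquandle.down (toFun a) (toFun b)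
  map_downBar : ∀ a b, toFun (Biquandle.downBar a b) = Biquandle.downBar (toFun a) (toFun b)

namespace Biquandle

/-- The operations `op_1, …, op_4`: `upBar`, `up`, `downBar`, `down`. -/
def op {B : Type u} [Biquandle B] : Fin 4 → B → B → B := ![upBar, up, downBar, down]

theorem op_surjective {B : Type u} [Biquandle B] (i : Fin 4) (y : B) :
    Function.Surjective fun x : B => op i x y := by
  intro a
  fin_cases i
  · obtain ⟨x, -, h, -⟩ := exists_bar a y
    exact ⟨x, h.symm⟩
  · obtain ⟨x, -, h, -⟩ := exists_unbar a y
    exact ⟨x, h.symm⟩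
  · obtain ⟨x, -, -, h⟩ := exists_unbar y a
    exact ⟨_, h.symm⟩
  · obtain ⟨x, -, -, h⟩ := exists_bar y a
    exact ⟨_, h.symm⟩

theorem op_bijective {B : Type u} [Biquandle B] [Finite B] (i : Fin 4) (y : B) :
    Function.Bijective fun x : B => op i x y :=
  Function.Surjective.bijective_of_finite (op_surjective i y)

end Biquandle

/-! ### The knot biquandle -/

/-- Biquandle words in the generators `X`. Besides the four operations there are the solutions required
by the axioms: `divUp a b` is the solution `y` of `y ^ b = a`, and `divUpBar a b` is the solution `x` of
the same equation for the barred operation. -/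
inductive BWord (X : Type v) : Type v
  | gen (x : X) : BWord X
  | up (a b : BWord X) : BWord X
  | upBar (a b : BWord X) : BWord X
  | down (a b : BWord X) : BWord X
  | downBar (a b : BWord X) : BWord X
  | divUp (a b : BWord X) : BWord X
  | divUpBar (a b : BWord X) : BWord X

/-- The equivalence of biquandle words generated by the biquandle axioms and the relations `R`. The
solutions `divUp` and `divUpBar` are unique; so the `x` that the last axiom requires for `a`
can only be `divUp a a`, which gives the rule `kink`. -/
inductive BWord.Eqv {X : Type v} (R : BWord X → BWord X → Prop) : BWord X → BWord X → Prop
  | rel {a b} : R a b → Eqv R a b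
  | refl (a) : Eqv R a a
  | symm {a b} : Eqv R a b → Eqv R b a
  | trans {a b c} : Eqv R a b → Eqv R b c → Eqv R a c
  | up {a a' b b'} : Eqv R a a' → Eqv R b b' → Eqv R (.up a b) (.up a' b')
  | upBar {a a' b b'} : Eqv R a a' → Eqv R b b' → Eqv R (.upBar a b) (.upBar a' b')
  | down {a a' b b'} : Eqv R a a' → Eqv R b b' → Eqv R (.down a b) (.down a' b')
  | downBar {a a' b b'} : Eqv R a a' → Eqv R b b' → Eqv R (.downBar a b) (.downBar a' b')
  | divUp {a a' b b'} : Eqv R a a' → Eqv R b b' → Eqv R (.divUp a b) (.divUp a' b')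
  | divUpBar {a a' b b'} : Eqv R a a' → Eqv R b b' → Eqv R (.divUpBar a b) (.divUpBar a' b')
  | inv_up (a b) : Eqv R a (.upBar (.up a b) (.down b a))
  | inv_down (a b) : Eqv R b (.downBar (.down b a) (.up a b))
  | inv_upBar (a b) : Eqv R a (.up (.upBar a b) (.downBar b a))
  | inv_downBar (a b) : Eqv R b (.down (.downBar b a) (.upBar a b))
  | up_divUp (a b) : Eqv R (.up (.divUp a b) b) a
  | divUp_up (a b) : Eqv R (.divUp (.up a b) b) a
  | upBar_divUpBar (a b) : Eqv R (.upBar (.divUpBar a b) b) a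
  | divUpBar_upBar (a b) : Eqv R (.divUpBar (.upBar a b) b) a
  | braid_up (a b c) : Eqv R (.up (.up a b) c) (.up (.up a (.down c b)) (.up b c))
  | braid_down (a b c) : Eqv R (.down (.down c b) a) (.down (.down c (.up a b)) (.down b a))
  | braid_mid (a b c) :
      Eqv R (.up (.down b a) (.down c (.up a b))) (.down (.up b c) (.up a (.down c b)))
  | braid_upBar (a b c) :
      Eqv R (.upBar (.upBar a b) c) (.upBar (.upBar a (.downBar c b)) (.upBar b c))
  | braid_downBar (a b c) :
      Eqv R (.downBar (.downBar c b) a) (.downBar (.downBar c (.upBar a b)) (.downBar b a))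
  | braid_midBar (a b c) :
      Eqv R (.upBar (.downBar b a) (.downBar c (.upBar a b)))
        (.downBar (.upBar b c) (.upBar a (.downBar c b)))
  | kink (a) : Eqv R (.divUp a a) (.down a (.divUp a a))

/-- The setoid of equivalent biquandle words. -/
def BWord.setoid {X : Type v} (R : BWord X → BWord X → Prop) : Setoid (BWord X) where
  r := BWord.Eqv R
  iseqv := ⟨.refl, .symm, .trans⟩

/-- The biquandle presented by the generators `X` and the relations `R`. -/
def PresentedBiquandle {X : Type v} (R : BWord X → BWord X → Prop) : Type v := Quotient (BWord.setoid R)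

instance {X : Type v} (R : BWord X → BWord X → Prop) : Biquandle (PresentedBiquandle R) where
  up := Quotient.map₂ BWord.up fun _ _ h _ _ k => BWord.Eqv.up h k
  upBar := Quotient.map₂ BWord.upBar fun _ _ h _ _ k => BWord.Eqv.upBar h k
  down := Quotient.map₂ BWord.down fun _ _ h _ _ k => BWord.Eqv.down h k
  downBar := Quotient.map₂ BWord.downBar fun _ _ h _ _ k => BWord.Eqv.downBar h k
  inv_up := by
    rintro ⟨a⟩ ⟨b⟩
    exact Quotient.sound (.inv_up a b)
  inv_down := by
    rintro ⟨a⟩ ⟨b⟩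
    exact Quotient.sound (.inv_down a b)
  inv_upBar := by
    rintro ⟨a⟩ ⟨b⟩
    exact Quotient.sound (.inv_upBar a b)
  inv_downBar := by
    rintro ⟨a⟩ ⟨b⟩
    exact Quotient.sound (.inv_downBar a b)
  exists_bar := by
    rintro ⟨a⟩ ⟨b⟩
    have h := BWord.Eqv.upBar_divUpBar (R := R) a b
    refine ⟨Quotient.mk _ (.divUpBar a b), Quotient.sound ?_, Quotient.sound h.symm, Quotient.sound ?_⟩
    · exact (BWord.Eqv.inv_upBar _ b).trans (.up h (.refl _))
    · exact (BWord.Eqv.inv_downBar (.divUpBar a b) b).trans (.down (.refl _) h)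
  exists_unbar := by
    rintro ⟨a⟩ ⟨b⟩
    have h := BWord.Eqv.up_divUp (R := R) a b
    refine ⟨Quotient.mk _ (.divUp a b), Quotient.sound ?_, Quotient.sound h.symm, Quotient.sound ?_⟩
    · exact (BWord.Eqv.inv_up _ b).trans (.upBar h (.refl _))
    · exact (BWord.Eqv.inv_down (.divUp a b) b).trans (.downBar (.refl _) h)
  braid_up := by
    rintro ⟨a⟩ ⟨b⟩ ⟨c⟩
    exact Quotient.sound (.braid_up a b c)
  braid_down := by
    rintro ⟨a⟩ ⟨b⟩ ⟨c⟩
    exact Quotient.sound (.braid_down a b c)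
  braid_mid := by
    rintro ⟨a⟩ ⟨b⟩ ⟨c⟩
    exact Quotient.sound (.braid_mid a b c)
  braid_upBar := by
    rintro ⟨a⟩ ⟨b⟩ ⟨c⟩
    exact Quotient.sound (.braid_upBar a b c)
  braid_downBar := by
    rintro ⟨a⟩ ⟨b⟩ ⟨c⟩
    exact Quotient.sound (.braid_downBar a b c)
  braid_midBar := by
    rintro ⟨a⟩ ⟨b⟩ ⟨c⟩
    exact Quotient.sound (.braid_midBar a b c)
  kink := by
    rintro ⟨a⟩
    refine ⟨Quotient.mk _ (.divUp a a),
      ⟨Quotient.sound (.kink a), Quotient.sound (BWord.Eqv.up_divUp a a).symm⟩, ?_⟩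
    rintro ⟨x⟩ ⟨-, h⟩
    have h' : BWord.Eqv R a (.up x a) := Quotient.exact h
    exact Quotient.sound ((BWord.Eqv.divUp_up x a).symm.trans (.divUp h'.symm (.refl a)))
  kinkBar := by
    rintro ⟨a⟩
    have h1 := BWord.Eqv.kink (R := R) a
    have h2 := BWord.Eqv.up_divUp (R := R) a a
    refine ⟨Quotient.mk _ (.divUp a a), ⟨Quotient.sound ?_, Quotient.sound ?_⟩, ?_⟩
    · exact (BWord.Eqv.inv_up _ a).trans (.upBar h2 h1.symm)
    · exact (BWord.Eqv.inv_down (.divUp a a) a).trans (.downBar h1.symm h2)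
    · rintro ⟨y⟩ ⟨h, k⟩
      have h' : BWord.Eqv R y (.upBar a y) := Quotient.exact h
      have k' : BWord.Eqv R a (.downBar y a) := Quotient.exact k
      have e : BWord.Eqv R a (.up y a) := (BWord.Eqv.inv_upBar a y).trans (.up h'.symm k'.symm)
      exact Quotient.sound ((BWord.Eqv.divUp_up y a).symm.trans (.divUp e.symm (.refl a)))

/-- The relations of the knot biquandle: at a positive crossing with incoming under-edge `a` and incoming
over-edge `b` the outgoing under-edge is `a ^ b` and the outgoing over-edge is `b _ a`; at a negative
crossing the barred operations are used. -/
inductive Diagram.BRel (D : Diagram) : BWord D.Edge → BWord D.Edge → Prop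
  | posUnder (oi oo ui uo : D.Edge) (h : .crossing true oi.1 oo.1 ui.1 uo.1 ∈ D.verts) :
      BRel D (.gen uo) (.up (.gen ui) (.gen oi))
  | posOver (oi oo ui uo : D.Edge) (h : .crossing true oi.1 oo.1 ui.1 uo.1 ∈ D.verts) :
      BRel D (.gen oo) (.down (.gen oi) (.gen ui))
  | negUnder (oi oo ui uo : D.Edge) (h : .crossing false oi.1 oo.1 ui.1 uo.1 ∈ D.verts) :
      BRel D (.gen uo) (.upBar (.gen ui) (.gen oi))
  | negOver (oi oo ui uo : D.Edge) (h : .crossing false oi.1 oo.1 ui.1 uo.1 ∈ D.verts) :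
      BRel D (.gen oo) (.downBar (.gen oi) (.gen ui))
  | point (a b : D.Edge) (h : .point a.1 b.1 ∈ D.verts) : BRel D (.gen b) (.gen a)

/-- The knot biquandle `B(L)` of the link with diagram `D`. -/
abbrev Diagram.B (D : Diagram) : Type := PresentedBiquandle D.BRel

/-- There are finitely many homomorphisms from the knot biquandle to a finite biquandle. -/
instance (D : Diagram) (T : Type u) [Biquandle T] [Finite T] : Finite (BiquandleHom D.B T) := by
  refine Finite.of_injective (fun (f : BiquandleHom D.B T) (x : D.Edge) =>
    f.toFun (Quotient.mk (BWord.setoid D.BRel) (.gen x))) ?_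
  intro f g h
  ext q
  let mk : BWord D.Edge → D.B := Quotient.mk (BWord.setoid D.BRel)
  induction q using Quotient.inductionOn with
  | h w =>
    change f.toFun (mk w) = g.toFun (mk w)
    induction w with
    | gen x => exact congrFun h x
    | up a b iha ihb =>
      have e : mk (.up a b) = Biquandle.up (mk a) (mk b) := rfl
      rw [e, f.map_up, g.map_up, iha, ihb]
    | upBar a b iha ihb =>
      have e : mk (.upBar a b) = Biquandle.upBar (mk a) (mk b) := rfl
      rw [e, f.map_upBar, g.map_upBar, iha, ihb]
    | down a b iha ihb =>
      have e : mk (.down a b) = Biquandle.down (mk a) (mk b) := rfl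
      rw [e, f.map_down, g.map_down, iha, ihb]
    | downBar a b iha ihb =>
      have e : mk (.downBar a b) = Biquandle.downBar (mk a) (mk b) := rfl
      rw [e, f.map_downBar, g.map_downBar, iha, ihb]
    | divUp a b iha ihb =>
      have e : mk a = Biquandle.up (mk (.divUp a b)) (mk b) :=
        (Quotient.sound (BWord.Eqv.up_divUp a b)).symm
      rw [e, f.map_up, g.map_up, ihb] at iha
      exact (Biquandle.op_bijective 1 _).1 iha
    | divUpBar a b iha ihb =>
      have e : mk a = Biquandle.upBar (mk (.divUpBar a b)) (mk b) :=
        (Quotient.sound (BWord.Eqv.upBar_divUpBar a b)).symm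
      rw [e, f.map_upBar, g.map_upBar, ihb] at iha
      exact (Biquandle.op_bijective 0 _).1 iha

/-! ### Subbiquandle polynomials -/

/-- A subbiquandle: a subset closed under the four operations that is itself a biquandle, so that it
contains the elements whose existence the axioms require. -/
structure Subbiquandle (B : Type u) [Biquandle B] where
  carrier : Set B
  op_mem : ∀ (i : Fin 4) {a b}, a ∈ carrier → b ∈ carrier → Biquandle.op i a b ∈ carrier
  exists_bar_mem : ∀ {a b}, a ∈ carrier → b ∈ carrier → ∃ x ∈ carrier, a = Biquandle.upBar x b
  exists_unbar_mem : ∀ {a b}, a ∈ carrier → b ∈ carrier → ∃ y ∈ carrier, a = Biquandle.up y b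
  kink_mem : ∀ {a}, a ∈ carrier → ∃ x ∈ carrier, x = Biquandle.down a x ∧ a = Biquandle.up x a
  kinkBar_mem : ∀ {a}, a ∈ carrier →
    ∃ y ∈ carrier, y = Biquandle.upBar a y ∧ a = Biquandle.downBar y a

/-- The image of a biquandle homomorphism. -/
def Subbiquandle.image {A : Type v} {B : Type u} [Biquandle A] [Biquandle B] (f : BiquandleHom A B) :
    Subbiquandle B where
  carrier := Set.range f.toFun
  op_mem := by
    rintro i _ _ ⟨x, rfl⟩ ⟨y, rfl⟩
    fin_cases i
    · exact ⟨_, f.map_upBar x y⟩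
    · exact ⟨_, f.map_up x y⟩
    · exact ⟨_, f.map_downBar x y⟩
    · exact ⟨_, f.map_down x y⟩
  exists_bar_mem := by
    rintro _ _ ⟨a, rfl⟩ ⟨b, rfl⟩
    obtain ⟨x, -, h, -⟩ := Biquandle.exists_bar a b
    exact ⟨f.toFun x, ⟨x, rfl⟩, by rw [← f.map_upBar, ← h]⟩
  exists_unbar_mem := by
    rintro _ _ ⟨a, rfl⟩ ⟨b, rfl⟩
    obtain ⟨x, -, h, -⟩ := Biquandle.exists_unbar a b
    exact ⟨f.toFun x, ⟨x, rfl⟩, by rw [← f.map_up, ← h]⟩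
  kink_mem := by
    rintro _ ⟨a, rfl⟩
    obtain ⟨x, ⟨h, k⟩, -⟩ := Biquandle.kink a
    exact ⟨f.toFun x, ⟨x, rfl⟩, by rw [← f.map_down, ← h], by rw [← f.map_up, ← k]⟩
  kinkBar_mem := by
    rintro _ ⟨a, rfl⟩
    obtain ⟨x, ⟨h, k⟩, -⟩ := Biquandle.kinkBar a
    exact ⟨f.toFun x, ⟨x, rfl⟩, by rw [← f.map_upBar, ← h], by rw [← f.map_downBar, ← k]⟩

noncomputable section

/-- `op_i ^ n (x, y)` for an integer `n`: the `n`-th power of the permutation `op_i (-, y)`, at `x`. -/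
def opPow {B : Type u} [Biquandle B] [Finite B] (i : Fin 4) (n : ℤ) (x y : B) : B :=
  ((Equiv.ofBijective _ (Biquandle.op_bijective i y) : Equiv.Perm B) ^ n) x

/-- `r^i_m(x)` is the number of `y` with `op_i ^ m (x, y) = x`. -/
def birowCount {B : Type u} [Biquandle B] [Finite B] (i : Fin 4) (m : ℤ) (x : B) : ℕ :=
  {y : B | opPow i m x y = x}.ncard

/-- `c^i_n(x)` is the number of `y` with `op_i ^ n (y, x) = y`. -/
def bicolCount {B : Type u} [Biquandle B] [Finite B] (i : Fin 4) (n : ℤ) (x : B) : ℕ :=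
  {y : B | opPow i n y x = y}.ncard

/-- The subbiquandle polynomial of `S ⊂ B`, in the variables `s_i = X (inl i)` and `t_i = X (inr i)`. -/
def sbp {B : Type u} [Biquandle B] [Finite B] (m n : ℤ) (S : Subbiquandle B) :
    MvPolynomial (Fin 4 ⊕ Fin 4) ℤ :=
  ∑ᶠ x ∈ S.carrier,
    (∏ i : Fin 4, .X (.inl i) ^ birowCount i m x) * ∏ i : Fin 4, .X (.inr i) ^ bicolCount i n x

/-- The subbiquandle polynomial invariant as a multiset. -/
def PhiSbp (m n : ℤ) (D : Diagram) (T : Type u) [Biquandle T] [Finite T] :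
    Multiset (MvPolynomial (Fin 4 ⊕ Fin 4) ℤ) :=
  values fun f : BiquandleHom D.B T => sbp m n (Subbiquandle.image f)

/-- The subbiquandle polynomial invariant in polynomial form. -/
def phiSbp (m n : ℤ) (D : Diagram) (T : Type u) [Biquandle T] [Finite T] :
    AddMonoidAlgebra ℤ (MvPolynomial (Fin 4 ⊕ Fin 4) ℤ) :=
  powerSum fun f : BiquandleHom D.B T => sbp m n (Subbiquandle.image f)

end

end LinkPoly

/-!
A homomorphism from the knot quandle or knot biquandle to `T` is the same as a colouring of the edges of
the diagram by elements of `T` that obeys a rule at every crossing, and its image is the substructure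
generated by the colours. Since the polynomials depend on the homomorphism only through its image, it
suffices to find, for each move, a bijection of colourings such that corresponding colourings take their
values in the same closed subsets of `T` (`SameColorings`, `Move.sameColorings`). A quandle is a
biquandle with trivial subscript operations (`biquandleOfQuandle`), with the same colourings and the
same closed subsets, so only biquandles have to be treated.

Let `X oi oo ui uo` be the rule `uo = ui ^ oi`, `oo = oi _ ui` of a positive crossing. By the axioms
`inv_up`, …, `inv_downBar` a negative crossing obeys the same rule with incoming and outgoing edges
exchanged (`crosses_not_iff`). As `T` is finite, all right multiplications are permutations, and
therefore the colour of either over-edge together with that of either under-edge determines all four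
colours (`exists_crosses_overIn_underIn` and its variants for existence, `OpCompatible.crosses` for
uniqueness). This settles the second Reidemeister move. For the first one, finiteness shows that either
of the two equations in `kink`, and in `kinkBar`, implies the other (`eq_down_iff_eq_up`,
`eq_upBar_iff_eq_downBar`).

The two sides of the third Reidemeister move on positive crossings form the six faces of a cube, and the
braid axioms say that a colouring of the three faces at one distinguished vertex, or at the opposite
one, extends to the cube. The other versions of the move say the same about the other six vertices.
There, two of the given faces belong to one of the two sides; completing that side by its third face,
applying the braid axioms, and comparing the new face with the remaining given one proves the claim
(`Cube.exists_of_unprimed_except_tb` and its variants, `TriangleColored.exists_other_side`).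

Uniqueness of corresponding colourings and the claim on closed subsets have a common form: a relation on
`T` that is compatible with the operations, and holds between two colourings on the boundary of the
changed part, also holds on its inner edges. Equality gives the former, membership the latter
(`OpCompatible`, `sameColorings_of_replacement`).
-/

namespace LinkPoly

/-! ### Crossings coloured by a finite biquandle -/

section Crossings

open Biquandle

/-- The colouring rule of a crossing of sign `p` whose incoming over-edge, outgoing over-edge, incoming
under-edge and outgoing under-edge have the colours `oi`, `oo`, `ui`, `uo`. -/
def Crosses {T : Type u} [Biquandle T] : Bool → T → T → T → T → Prop
  | true, oi, oo, ui, uo => uo = up ui oi ∧ oo = down oi ui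
  | false, oi, oo, ui, uo => uo = upBar ui oi ∧ oo = downBar oi ui

/-- A binary relation on a biquandle that is compatible with the four operations. Equality is the case
used for the uniqueness of colours; `a ∈ S`, as a relation that ignores its second argument, is the
case used for colours that stay in a closed set `S`. -/
def OpCompatible {T : Type u} [Biquandle T] (R : T → T → Prop) : Prop :=
  ∀ (i : Fin 4) {a a' b b' : T}, R a a' → R b b' → R (op i a b) (op i a' b')

/-- A subset of a biquandle that is closed under the four operations. -/
def OpClosed {T : Type u} [Biquandle T] (S : Set T) : Prop :=
  ∀ (i : Fin 4) {a b : T}, a ∈ S → b ∈ S → op i a b ∈ S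

variable {T : Type u} [Biquandle T]

theorem opCompatible_eq : OpCompatible (fun a b : T => a = b) := by
  rintro i a _ b _ rfl rfl
  rfl

/-- Membership in a closed set, as a relation that ignores its second argument. -/
theorem OpClosed.opCompatible {S : Set T} (hS : OpClosed S) : OpCompatible fun a _ : T => a ∈ S :=
  fun i _ _ _ _ ha hb => hS i ha hb

/-- A crossing of the opposite sign obeys the same rule with incoming and outgoing edges exchanged. -/
theorem crosses_not_iff (p : Bool) (oi oo ui uo : T) :
    Crosses (!p) oi oo ui uo ↔ Crosses p oo oi uo ui := by
  cases p
  · constructor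
    · rintro ⟨rfl, rfl⟩
      exact ⟨inv_up _ _, inv_down _ _⟩
    · rintro ⟨rfl, rfl⟩
      exact ⟨inv_upBar _ _, inv_downBar _ _⟩
  · constructor
    · rintro ⟨rfl, rfl⟩
      exact ⟨inv_upBar _ _, inv_downBar _ _⟩
    · rintro ⟨rfl, rfl⟩
      exact ⟨inv_up _ _, inv_down _ _⟩

theorem exists_crosses_overIn_underIn (p : Bool) (oi ui : T) : ∃ oo uo, Crosses p oi oo ui uo := by
  cases p <;> exact ⟨_, _, rfl, rfl⟩

theorem exists_crosses_overOut_underOut (p : Bool) (oo uo : T) : ∃ oi ui, Crosses p oi oo ui uo := by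
  obtain ⟨oi, ui, h⟩ := exists_crosses_overIn_underIn (!p) oo uo
  exact ⟨oi, ui, (crosses_not_iff _ _ _ _ _).1 h⟩

/-- A sideways extension, needed where the two strands run in opposite directions. -/
theorem exists_crosses_overIn_underOut (p : Bool) (oi uo : T) : ∃ oo ui, Crosses p oi oo ui uo := by
  cases p
  · obtain ⟨ui, rfl⟩ := op_surjective 0 oi uo
    exact ⟨_, ui, rfl, rfl⟩
  · obtain ⟨ui, rfl⟩ := op_surjective 1 oi uo
    exact ⟨_, ui, rfl, rfl⟩

theorem exists_crosses_overOut_underIn (p : Bool) (oo ui : T) : ∃ oi uo, Crosses p oi oo ui uo := by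
  cases p
  · obtain ⟨oi, rfl⟩ := op_surjective 2 ui oo
    exact ⟨oi, _, rfl, rfl⟩
  · obtain ⟨oi, rfl⟩ := op_surjective 3 ui oo
    exact ⟨oi, _, rfl, rfl⟩

variable [Finite T]

/-- In a finite biquandle a compatible relation is also compatible with the inverses of the right
multiplications: an injective self-map of the finite relation is onto. -/
theorem OpCompatible.of_op {R : T → T → Prop} (hR : OpCompatible R) (i : Fin 4) {a a' b b' : T}
    (ha : R (op i a b) (op i a' b')) (hb : R b b') : R a a' := by
  let F : {p : T × T // R p.1 p.2} → {p : T × T // R p.1 p.2} :=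
    fun p => ⟨(op i p.1.1 b, op i p.1.2 b'), hR i p.2 hb⟩
  have hF : Function.Injective F := by
    rintro ⟨⟨x, x'⟩, h⟩ ⟨⟨y, y'⟩, k⟩ e
    have e' := Prod.ext_iff.1 (congrArg Subtype.val e)
    exact Subtype.ext (Prod.ext ((op_bijective i b).1 e'.1) ((op_bijective i b').1 e'.2))
  obtain ⟨⟨⟨x, x'⟩, h⟩, e⟩ := Finite.surjective_of_injective hF ⟨(_, _), ha⟩
  have e' := Prod.ext_iff.1 (congrArg Subtype.val e)
  have h1 : x = a := (op_bijective i b).1 e'.1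
  have h2 : x' = a' := (op_bijective i b').1 e'.2
  exact h1 ▸ h2 ▸ h

/-- The colour of one edge of the over-strand and that of one edge of the under-strand determine all
colours at a crossing. -/
theorem OpCompatible.crosses {R : T → T → Prop} (hR : OpCompatible R) {p : Bool}
    {oi oo ui uo oi' oo' ui' uo' : T} (h : Crosses p oi oo ui uo) (h' : Crosses p oi' oo' ui' uo')
    (ho : R oi oi' ∨ R oo oo') (hu : R ui ui' ∨ R uo uo') :
    (R oi oi' ∧ R oo oo') ∧ R ui ui' ∧ R uo uo' := by
  -- It suffices to find the relation on the two incoming edges.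
  suffices hin : R oi oi' ∧ R ui ui' by
    obtain ⟨k, l⟩ := hin
    cases p <;> obtain ⟨rfl, rfl⟩ := h <;> obtain ⟨rfl, rfl⟩ := h'
    · exact ⟨⟨k, hR 2 k l⟩, l, hR 0 l k⟩
    · exact ⟨⟨k, hR 3 k l⟩, l, hR 1 l k⟩
  rcases ho with ho | ho <;> rcases hu with hu | hu
  · exact ⟨ho, hu⟩
  · cases p <;> obtain ⟨rfl, rfl⟩ := h <;> obtain ⟨rfl, rfl⟩ := h'
    · exact ⟨ho, hR.of_op 0 hu ho⟩
    · exact ⟨ho, hR.of_op 1 hu ho⟩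
  · cases p <;> obtain ⟨rfl, rfl⟩ := h <;> obtain ⟨rfl, rfl⟩ := h'
    · exact ⟨hR.of_op 2 ho hu, hu⟩
    · exact ⟨hR.of_op 3 ho hu, hu⟩
  · have k := (crosses_not_iff (!p) oi oo ui uo).1 (by simpa using h)
    have k' := (crosses_not_iff (!p) oi' oo' ui' uo').1 (by simpa using h')
    cases p <;> obtain ⟨rfl, rfl⟩ := k <;> obtain ⟨rfl, rfl⟩ := k'
    · exact ⟨hR 3 ho hu, hR 1 hu ho⟩
    · exact ⟨hR 2 ho hu, hR 0 hu ho⟩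

theorem Crosses.unique {p : Bool} {oi oo ui uo oi' oo' ui' uo' : T} (h : Crosses p oi oo ui uo)
    (h' : Crosses p oi' oo' ui' uo') (ho : oi = oi' ∨ oo = oo') (hu : ui = ui' ∨ uo = uo') :
    (oi = oi' ∧ oo = oo') ∧ ui = ui' ∧ uo = uo' :=
  opCompatible_eq.crosses h h' ho hu

/-! ### The first and second Reidemeister moves on colours -/

/-- Either equation of the axiom `kink` implies the other one: the solution is an injective, hence
bijective, function of `a`. -/
theorem eq_down_iff_eq_up (a x : T) : x = down a x ↔ a = up x a := by
  choose k hk _ using kink (B := T)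
  have hinj : Function.Injective k := fun a b h =>
    (op_bijective 3 (k a)).1 (show down a (k a) = down b (k a) by
      rw [← (hk a).1, h]; exact (hk b).1)
  constructor
  · intro h
    obtain ⟨b, rfl⟩ := Finite.surjective_of_injective hinj x
    obtain rfl : a = b := (op_bijective 3 (k b)).1 (h.symm.trans (hk b).1)
    exact (hk a).2
  · intro h
    obtain rfl : x = k a := (op_bijective 1 a).1 (h.symm.trans (hk a).2)
    exact (hk a).1

/-- Either equation of the axiom `kinkBar` implies the other one. -/
theorem eq_upBar_iff_eq_downBar (a y : T) : y = upBar a y ↔ a = downBar y a := by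
  choose k hk _ using kinkBar (B := T)
  have hinj : Function.Injective k := fun a b h =>
    (op_bijective 0 (k a)).1 (show upBar a (k a) = upBar b (k a) by
      rw [← (hk a).1, h]; exact (hk b).1)
  constructor
  · intro h
    obtain ⟨b, rfl⟩ := Finite.surjective_of_injective hinj y
    obtain rfl : a = b := (op_bijective 0 (k b)).1 (h.symm.trans (hk b).1)
    exact (hk a).2
  · intro h
    obtain rfl : y = k a := (op_bijective 2 a).1 (h.symm.trans (hk a).2)
    exact (hk a).1

/-- A strand that passes over and then under itself leaves the kink with the colour `a` with which it
entered. -/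
theorem Crosses.kinkOver_eq {p : Bool} {a l b : T} (h : Crosses p a l l b) : b = a := by
  cases p <;> obtain ⟨rfl, h⟩ := h
  · exact ((eq_upBar_iff_eq_downBar l a).2 h).symm
  · exact ((eq_down_iff_eq_up a l).1 h).symm

theorem Crosses.kinkUnder_eq {p : Bool} {a l b : T} (h : Crosses p l b a l) : b = a := by
  cases p <;> obtain ⟨h, rfl⟩ := h
  · exact ((eq_upBar_iff_eq_downBar a l).1 h).symm
  · exact ((eq_down_iff_eq_up l a).2 h).symm

theorem exists_kinkOver (p : Bool) (a : T) : ∃ l, Crosses p a l l a := by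
  cases p
  · obtain ⟨l, h⟩ := op_surjective 0 a a
    exact ⟨l, h.symm, (eq_upBar_iff_eq_downBar l a).1 h.symm⟩
  · obtain ⟨l, h⟩ := op_surjective 1 a a
    exact ⟨l, h.symm, (eq_down_iff_eq_up a l).2 h.symm⟩

theorem exists_kinkUnder (p : Bool) (a : T) : ∃ l, Crosses p l a a l := by
  cases p
  · obtain ⟨l, h⟩ := op_surjective 2 a a
    exact ⟨l, (eq_upBar_iff_eq_downBar a l).2 h.symm, h.symm⟩
  · obtain ⟨l, h⟩ := op_surjective 3 a a
    exact ⟨l, (eq_down_iff_eq_up l a).1 h.symm, h.symm⟩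

/-- Two parallel strands that cross twice, with opposite signs, leave with the colours `a`, `c` with
which they entered: both crossings obey the rule for sign `p` with the same outgoing colours `e`, `f`
of the first one. -/
theorem Crosses.parallel_eq {p : Bool} {a e b c f d : T} (h : Crosses p a e c f)
    (h' : Crosses (!p) e b f d) : b = a ∧ d = c := by
  have k := h.unique ((crosses_not_iff _ _ _ _ _).1 h') (.inr rfl) (.inr rfl)
  exact ⟨k.1.1.symm, k.2.1.symm⟩

theorem Crosses.antiparallel_eq {p : Bool} {a e b c f d : T} (h : Crosses p a e f d)
    (h' : Crosses (!p) e b c f) : b = a ∧ d = c := by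
  have k := h.unique ((crosses_not_iff _ _ _ _ _).1 h') (.inr rfl) (.inl rfl)
  exact ⟨k.1.1.symm, k.2.2⟩

end Crossings

/-! ### The third Reidemeister move on colours -/

section Triangles

open Biquandle

variable {T : Type u} [Biquandle T]

/-- The colours of a cube: the six faces are positive crossings of three strands, each of which meets
the other two in both orders. The faces with `t₁`, `m₁`, `b₁` form one side of the move on three
positive crossings, and the faces with `t₁'`, `m₁'`, `b₁'` form the other side. -/
structure Cube (t₀ t₁ t₁' t₂ m₀ m₁ m₁' m₂ b₀ b₁ b₁' b₂ : T) : Prop where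
  tb : Crosses true t₀ t₁ b₁ b₂
  tm : Crosses true t₁ t₂ m₁ m₂
  mb : Crosses true m₀ m₁ b₀ b₁
  tm' : Crosses true t₀ t₁' m₀ m₁'
  tb' : Crosses true t₁' t₂ b₀ b₁'
  mb' : Crosses true m₁' m₂ b₁' b₂

variable {t₀ t₁ t₁' t₂ m₀ m₁ m₁' m₂ b₀ b₁ b₁' b₂ : T}

/-- This case and the next one are the three braid axioms. -/
theorem Cube.exists_of_unprimed (htb : Crosses true t₀ t₁ b₁ b₂) (htm : Crosses true t₁ t₂ m₁ m₂)
    (hmb : Crosses true m₀ m₁ b₀ b₁) :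
    ∃ t₁' m₁' b₁', Cube t₀ t₁ t₁' t₂ m₀ m₁ m₁' m₂ b₀ b₁ b₁' b₂ := by
  have h1 := htb; have h2 := htm; have h3 := hmb
  obtain ⟨rfl, rfl⟩ := h3
  obtain ⟨rfl, rfl⟩ := h1
  obtain ⟨rfl, rfl⟩ := h2
  exact ⟨_, _, _, htb, htm, hmb, ⟨rfl, rfl⟩, ⟨rfl, (braid_down _ _ _).symm⟩,
    ⟨braid_up _ _ _, braid_mid _ _ _⟩⟩

theorem Cube.exists_of_primed (htm : Crosses true t₀ t₁' m₀ m₁') (htb : Crosses true t₁' t₂ b₀ b₁')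
    (hmb : Crosses true m₁' m₂ b₁' b₂) :
    ∃ t₁ m₁ b₁, Cube t₀ t₁ t₁' t₂ m₀ m₁ m₁' m₂ b₀ b₁ b₁' b₂ := by
  have h1 := htm; have h2 := htb; have h3 := hmb
  obtain ⟨rfl, rfl⟩ := h1
  obtain ⟨rfl, rfl⟩ := h2
  obtain ⟨rfl, rfl⟩ := h3
  exact ⟨_, _, _, ⟨(braid_up _ _ _).symm, rfl⟩, ⟨(braid_mid _ _ _).symm, braid_down _ _ _⟩,
    ⟨rfl, rfl⟩, htm, htb, hmb⟩

/-- The colours of the pair of edges `leg first` of a strand. -/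
def colorLeg (first : Bool) (e : Fin 3 → T) : T × T :=
  if first then (e 0, e 1) else (e 1, e 2)

/-- The colouring rule of a crossing, in terms of the colours `(incoming, outgoing)` of its over-strand
and of its under-strand. -/
def CrossColored (p : Bool) (o w : T × T) : Prop := Crosses p o.1 o.2 w.1 w.2

/-- The colouring rule for one side of the third Reidemeister move, in terms of the colours `t`, `m`,
`b` of the edges of the three strands; compare `triangle`. -/
def TriangleColored (side x y z : Bool) (t m b : Fin 3 → T) : Prop :=
  let p : Bool := (x == y) == z
  CrossColored x (colorLeg (side != p) t) (colorLeg (side != x) m) ∧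
    CrossColored y (colorLeg (side == p) t) (colorLeg (side != y) b) ∧
      CrossColored z (colorLeg (side == x) m) (colorLeg (side == y) b)

theorem crosses_false_iff (oi oo ui uo : T) : Crosses false oi oo ui uo ↔ Crosses true oo oi uo ui :=
  crosses_not_iff true oi oo ui uo

/-- Reversing all three strands changes all three signs. -/
theorem triangleColored_not (side x y z : Bool) (t m b : Fin 3 → T) :
    TriangleColored side (!x) (!y) (!z) t m b ↔
      TriangleColored side x y z ![t 2, t 1, t 0] ![m 2, m 1, m 0] ![b 2, b 1, b 0] := by
  cases side <;> cases x <;> cases y <;> cases z <;>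
    simp [TriangleColored, CrossColored, colorLeg, crosses_false_iff]

variable [Finite T]

/-- The cases of a vertex at which two unprimed faces and one primed face meet, or two primed faces and
one unprimed face, reduce to the previous ones: first complete the side with two faces by its third
face, and then use that the given face of the other side is unique. -/
theorem Cube.exists_of_unprimed_except_tb (htb : Crosses true t₁' t₂ b₀ b₁')
    (htm : Crosses true t₁ t₂ m₁ m₂) (hmb : Crosses true m₀ m₁ b₀ b₁) :
    ∃ t₀ m₁' b₂, Cube t₀ t₁ t₁' t₂ m₀ m₁ m₁' m₂ b₀ b₁ b₁' b₂ := by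
  obtain ⟨t₀, b₂, h⟩ := exists_crosses_overOut_underIn true t₁ b₁
  obtain ⟨t, m, b, c⟩ := Cube.exists_of_unprimed h htm hmb
  obtain ⟨⟨rfl, -⟩, -, rfl⟩ := c.tb'.unique htb (.inr rfl) (.inl rfl)
  exact ⟨_, _, _, c⟩

theorem Cube.exists_of_unprimed_except_tm (htb : Crosses true t₀ t₁ b₁ b₂)
    (htm : Crosses true t₀ t₁' m₀ m₁') (hmb : Crosses true m₀ m₁ b₀ b₁) :
    ∃ t₂ m₂ b₁', Cube t₀ t₁ t₁' t₂ m₀ m₁ m₁' m₂ b₀ b₁ b₁' b₂ := by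
  obtain ⟨t₂, m₂, h⟩ := exists_crosses_overIn_underIn true t₁ m₁
  obtain ⟨t, m, b, c⟩ := Cube.exists_of_unprimed htb h hmb
  obtain ⟨⟨-, rfl⟩, -, rfl⟩ := c.tm'.unique htm (.inl rfl) (.inl rfl)
  exact ⟨_, _, _, c⟩

theorem Cube.exists_of_unprimed_except_mb (htb : Crosses true t₀ t₁ b₁ b₂)
    (htm : Crosses true t₁ t₂ m₁ m₂) (hmb : Crosses true m₁' m₂ b₁' b₂) :
    ∃ t₁' m₀ b₀, Cube t₀ t₁ t₁' t₂ m₀ m₁ m₁' m₂ b₀ b₁ b₁' b₂ := by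
  obtain ⟨m₀, b₀, h⟩ := exists_crosses_overOut_underOut true m₁ b₁
  obtain ⟨t, m, b, c⟩ := Cube.exists_of_unprimed htb htm h
  obtain ⟨⟨rfl, -⟩, rfl, -⟩ := c.mb'.unique hmb (.inr rfl) (.inr rfl)
  exact ⟨_, _, _, c⟩

theorem Cube.exists_of_primed_except_tb (htb : Crosses true t₀ t₁ b₁ b₂)
    (htm : Crosses true t₀ t₁' m₀ m₁') (hmb : Crosses true m₁' m₂ b₁' b₂) :
    ∃ t₂ m₁ b₀, Cube t₀ t₁ t₁' t₂ m₀ m₁ m₁' m₂ b₀ b₁ b₁' b₂ := by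
  obtain ⟨t₂, b₀, h⟩ := exists_crosses_overIn_underOut true t₁' b₁'
  obtain ⟨t, m, b, c⟩ := Cube.exists_of_primed htm h hmb
  obtain ⟨⟨-, rfl⟩, rfl, -⟩ := c.tb.unique htb (.inl rfl) (.inr rfl)
  exact ⟨_, _, _, c⟩

theorem Cube.exists_of_primed_except_tm (htb : Crosses true t₁' t₂ b₀ b₁')
    (htm : Crosses true t₁ t₂ m₁ m₂) (hmb : Crosses true m₁' m₂ b₁' b₂) :
    ∃ t₀ m₀ b₁, Cube t₀ t₁ t₁' t₂ m₀ m₁ m₁' m₂ b₀ b₁ b₁' b₂ := by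
  obtain ⟨t₀, m₀, h⟩ := exists_crosses_overOut_underOut true t₁' m₁'
  obtain ⟨t, m, b, c⟩ := Cube.exists_of_primed h htb hmb
  obtain ⟨⟨rfl, -⟩, rfl, -⟩ := c.tm.unique htm (.inr rfl) (.inr rfl)
  exact ⟨_, _, _, c⟩

theorem Cube.exists_of_primed_except_mb (htb : Crosses true t₁' t₂ b₀ b₁')
    (htm : Crosses true t₀ t₁' m₀ m₁') (hmb : Crosses true m₀ m₁ b₀ b₁) :
    ∃ t₁ m₂ b₂, Cube t₀ t₁ t₁' t₂ m₀ m₁ m₁' m₂ b₀ b₁ b₁' b₂ := by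
  obtain ⟨m₂, b₂, h⟩ := exists_crosses_overIn_underIn true m₁' b₁'
  obtain ⟨t, m, b, c⟩ := Cube.exists_of_primed htm htb h
  obtain ⟨⟨-, rfl⟩, -, rfl⟩ := c.mb.unique hmb (.inl rfl) (.inl rfl)
  exact ⟨_, _, _, c⟩

/-- Every colouring of one side of the third Reidemeister move has the same boundary colours as some
colouring of the other side. Up to reversal of all strands, the eight cases are the eight ways to take
three faces of a cube that meet in a vertex. -/
theorem TriangleColored.exists_other_side {side x y z : Bool} {t m b : Fin 3 → T}
    (h : TriangleColored side x y z t m b) :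
    ∃ t₁ m₁ b₁, TriangleColored (!side) x y z ![t 0, t₁, t 2] ![m 0, m₁, m 2] ![b 0, b₁, b 2] := by
  -- It suffices to treat a positive crossing of the top strand and the bottom strand.
  have key : ∀ {x z : Bool} {t m b : Fin 3 → T}, TriangleColored side x true z t m b →
      ∃ t₁ m₁ b₁, TriangleColored (!side) x true z
        ![t 0, t₁, t 2] ![m 0, m₁, m 2] ![b 0, b₁, b 2] := by
    intro x z t m b h
    cases side <;> cases x <;> cases z <;>
      simp [TriangleColored, CrossColored, colorLeg, crosses_false_iff] at h ⊢ <;>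
      obtain ⟨hx, hy, hz⟩ := h
    · obtain ⟨_, _, _, c⟩ := Cube.exists_of_primed_except_tb hy hx hz
      exact ⟨_, _, c.tm, _, c.tb', c.mb⟩
    · obtain ⟨_, _, _, c⟩ := Cube.exists_of_primed_except_tm hy hx hz
      exact ⟨_, _, c.tm', _, c.tb, c.mb⟩
    · obtain ⟨_, _, _, c⟩ := Cube.exists_of_unprimed_except_mb hy hx hz
      exact ⟨_, _, c.tm', _, c.tb', c.mb⟩
    · obtain ⟨_, _, _, c⟩ := Cube.exists_of_primed hx hy hz
      exact ⟨_, _, c.tm, _, c.tb, c.mb⟩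
    · obtain ⟨_, _, _, c⟩ := Cube.exists_of_unprimed_except_tb hy hx hz
      exact ⟨_, _, c.tm', _, c.tb, c.mb'⟩
    · obtain ⟨_, _, _, c⟩ := Cube.exists_of_unprimed_except_tm hy hx hz
      exact ⟨_, _, c.tm, _, c.tb', c.mb'⟩
    · obtain ⟨_, _, _, c⟩ := Cube.exists_of_primed_except_mb hy hx hz
      exact ⟨_, _, c.tm, _, c.tb, c.mb'⟩
    · obtain ⟨_, _, _, c⟩ := Cube.exists_of_unprimed hy hx hz
      exact ⟨_, _, c.tm', _, c.tb', c.mb'⟩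
  cases y
  · rw [← Bool.not_true, ← Bool.not_not x, ← Bool.not_not z, triangleColored_not] at h
    obtain ⟨t₁, m₁, b₁, k⟩ := key h
    refine ⟨t₁, m₁, b₁, ?_⟩
    rw [← Bool.not_true, ← Bool.not_not x, ← Bool.not_not z, triangleColored_not]
    exact k
  · exact key h

theorem OpCompatible.crossColored_colorLeg {R : T → T → Prop} (hR : OpCompatible R) {p f g : Bool}
    {o o' w w' : Fin 3 → T} (h : CrossColored p (colorLeg f o) (colorLeg g w))
    (h' : CrossColored p (colorLeg f o') (colorLeg g w')) (ho : R (o 0) (o' 0) ∧ R (o 2) (o' 2))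
    (hw : R (w 0) (w' 0) ∧ R (w 2) (w' 2)) : R (o 1) (o' 1) ∧ R (w 1) (w' 1) := by
  cases f <;> cases g
  · have k := hR.crosses h h' (.inr ho.2) (.inr hw.2)
    exact ⟨k.1.1, k.2.1⟩
  · have k := hR.crosses h h' (.inr ho.2) (.inl hw.1)
    exact ⟨k.1.1, k.2.2⟩
  · have k := hR.crosses h h' (.inl ho.1) (.inr hw.2)
    exact ⟨k.1.2, k.2.1⟩
  · have k := hR.crosses h h' (.inl ho.1) (.inl hw.1)
    exact ⟨k.1.2, k.2.2⟩

/-- The colours of the boundary edges of a triangle determine those of the three inner edges: each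
crossing has one boundary edge on its over-strand and one on its under-strand. -/
theorem OpCompatible.triangleColored {R : T → T → Prop} (hR : OpCompatible R) {side x y z : Bool}
    {t t' m m' b b' : Fin 3 → T} (h : TriangleColored side x y z t m b)
    (h' : TriangleColored side x y z t' m' b') (ht : R (t 0) (t' 0) ∧ R (t 2) (t' 2))
    (hm : R (m 0) (m' 0) ∧ R (m 2) (m' 2)) (hb : R (b 0) (b' 0) ∧ R (b 2) (b' 2)) :
    R (t 1) (t' 1) ∧ R (m 1) (m' 1) ∧ R (b 1) (b' 1) := by
  obtain ⟨h₁, h₂⟩ := hR.crossColored_colorLeg h.1 h'.1 ht hm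
  exact ⟨h₁, h₂, (hR.crossColored_colorLeg h.2.1 h'.2.1 ht hb).2⟩

end Triangles

/-! ### Colourings of diagrams -/

section Colorings

/-- The colouring rule at a vertex. -/
def Vertex.Colored {A : Type} {T : Type u} [Biquandle T] (c : A → T) : Vertex A → Prop
  | .crossing p oi oo ui uo => Crosses p (c oi) (c oo) (c ui) (c uo)
  | .point a b => c b = c a

/-- The colouring rule at all vertices of a part of a diagram. -/
def ColoredAll {T : Type u} [Biquandle T] (c : ℕ → T) (M : Multiset (Vertex ℕ)) : Prop :=
  ∀ v ∈ M, v.Colored c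

/-- A colouring of a diagram by a biquandle: the edges get colours that obey the rule at every
vertex. -/
def Coloring (D : Diagram) (T : Type u) [Biquandle T] : Type u :=
  {c : D.Edge → T // ∀ v : Vertex D.Edge, v.map (fun a => a.1) ∈ D.verts → v.Colored c}

/-- Two diagrams have corresponding colourings if there is a bijection between their colourings by
which corresponding colourings take their values in the same closed subsets. -/
def SameColorings (T : Type u) [Biquandle T] (D D' : Diagram) : Prop :=
  ∃ e : Coloring D T ≃ Coloring D' T, ∀ (c : Coloring D T) (S : Set T), OpClosed S →
    ((∀ a, c.1 a ∈ S) ↔ ∀ a, (e c).1 a ∈ S)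

theorem sameColorings_equivalence (T : Type u) [Biquandle T] : Equivalence (SameColorings T) where
  refl _ := ⟨Equiv.refl _, fun _ _ _ => Iff.rfl⟩
  symm := by
    rintro D D' ⟨e, he⟩
    refine ⟨e.symm, fun c S hS => ?_⟩
    rw [he _ S hS, e.apply_symm_apply]
  trans := by
    rintro D D' D'' ⟨e, he⟩ ⟨f, hf⟩
    exact ⟨e.trans f, fun c S hS => (he c S hS).trans (hf _ S hS)⟩

variable {T : Type u} [Biquandle T]

theorem Vertex.colored_map {A B : Type} (g : A → B) (c : B → T) (v : Vertex A) :
    (v.map g).Colored c ↔ v.Colored (c ∘ g) := by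
  cases v <;> rfl

theorem Vertex.Colored.congr {A : Type} {c c' : A → T} {v : Vertex A} (h : v.Colored c)
    (hi : ∀ a ∈ v.ins, c' a = c a) (ho : ∀ a ∈ v.outs, c' a = c a) : v.Colored c' := by
  cases v with
  | crossing p oi oo ui uo =>
    simp only [Vertex.ins, Vertex.outs, Multiset.insert_eq_cons, Multiset.mem_cons,
      Multiset.mem_singleton, forall_eq_or_imp, forall_eq] at hi ho
    simpa only [Vertex.Colored, hi, ho] using h
  | point a b =>
    simp only [Vertex.ins, Vertex.outs, Multiset.mem_singleton, forall_eq] at hi ho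
    simpa only [Vertex.Colored, hi, ho] using h

theorem ColoredAll.congr {c c' : ℕ → T} {M : Multiset (Vertex ℕ)} (h : ColoredAll c M)
    (hi : ∀ a ∈ M.bind Vertex.ins, c' a = c a) (ho : ∀ a ∈ M.bind Vertex.outs, c' a = c a) :
    ColoredAll c' M := fun v hv =>
  (h v hv).congr (fun a ha => hi a (Multiset.mem_bind.2 ⟨v, hv, ha⟩))
    fun a ha => ho a (Multiset.mem_bind.2 ⟨v, hv, ha⟩)

theorem coloredAll_add {c : ℕ → T} {M N : Multiset (Vertex ℕ)} :
    ColoredAll c (M + N) ↔ ColoredAll c M ∧ ColoredAll c N := by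
  simp only [ColoredAll, Multiset.mem_add, or_imp, forall_and]

theorem coloredAll_map {c : ℕ → T} {M : Multiset (Vertex ℕ)} {g : ℕ → ℕ} :
    ColoredAll c (M.map (Vertex.map g)) ↔ ColoredAll (c ∘ g) M := by
  simp only [ColoredAll, Multiset.mem_map, forall_exists_index, and_imp, forall_apply_eq_imp_iff₂,
    Vertex.colored_map]

theorem Vertex.exists_map_val {A : Type} {s : A → Prop} (v : Vertex A) (hi : ∀ a ∈ v.ins, s a)
    (ho : ∀ a ∈ v.outs, s a) : ∃ w : Vertex {a // s a}, w.map (fun a => a.1) = v := by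
  cases v with
  | crossing p oi oo ui uo =>
    simp only [Vertex.ins, Vertex.outs, Multiset.insert_eq_cons, Multiset.mem_cons,
      Multiset.mem_singleton, forall_eq_or_imp, forall_eq] at hi ho
    exact ⟨.crossing p ⟨oi, hi.1⟩ ⟨oo, ho.1⟩ ⟨ui, hi.2⟩ ⟨uo, ho.2⟩, rfl⟩
  | point a b =>
    simp only [Vertex.ins, Vertex.outs, Multiset.mem_singleton, forall_eq] at hi ho
    exact ⟨.point ⟨a, hi⟩ ⟨b, ho⟩, rfl⟩

/-- The edges of a diagram, as natural numbers. -/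
def Diagram.edges (D : Diagram) : Multiset ℕ := D.verts.bind Vertex.ins

/-- Restriction of a colouring of all natural numbers to the edges of a diagram. -/
def Coloring.restrict {D : Diagram} (c : ℕ → T) (h : ColoredAll c D.verts) : Coloring D T :=
  ⟨fun a => c a.1, fun v hv => (Vertex.colored_map _ c v).1 (h _ hv)⟩

/-- The extension of a colouring to all natural numbers lets colourings of different diagrams be
compared; the colours of numbers that are not edges do not matter. -/
theorem Coloring.exists_extension [Nonempty T] {D : Diagram} (c : Coloring D T) :
    ∃ k : ℕ → T, ColoredAll k D.verts ∧ ∀ a : D.Edge, c.1 a = k a.1 := by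
  classical
  let k : ℕ → T := fun a =>
    if h : a ∈ D.verts.bind Vertex.ins then c.1 ⟨a, h⟩ else Classical.arbitrary T
  have hk : ∀ a : D.Edge, c.1 a = k a.1 := fun a => by
    have h : a.1 ∈ D.verts.bind Vertex.ins := a.2
    simp only [k, dif_pos h]
    rfl
  refine ⟨k, fun v hv => ?_, hk⟩
  obtain ⟨w, rfl⟩ := v.exists_map_val (s := fun a => a ∈ D.verts.bind Vertex.ins)
    (fun a ha => Multiset.mem_bind.2 ⟨v, hv, ha⟩)
    (fun a ha => by rw [D.ins_eq_outs]; exact Multiset.mem_bind.2 ⟨v, hv, ha⟩)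
  have h := c.2 w hv
  rw [funext hk] at h
  exact (Vertex.colored_map _ k w).2 h

theorem Coloring.nonempty {D : Diagram} (h : D.verts ≠ 0) (c : Coloring D T) : Nonempty T := by
  obtain ⟨v, hv⟩ := Multiset.exists_mem_of_ne_zero h
  have : ∃ a, a ∈ v.ins := by
    cases v with
    | crossing p oi oo ui uo => exact ⟨oi, by simp [Vertex.ins]⟩
    | point a b => exact ⟨a, by simp [Vertex.ins]⟩
  obtain ⟨a, ha⟩ := this
  exact ⟨c.1 ⟨a, Multiset.mem_bind.2 ⟨v, hv, ha⟩⟩⟩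

/-- A correspondence `C` between the edges of two diagrams gives a bijection of colourings if colourings
can be carried over along `C` in both directions and the colours of the edges related by `C` determine
all colours. Determination is required for all compatible relations at once, which yields both the
uniqueness of the corresponding colouring and the claim on closed subsets. -/
theorem sameColorings_of_correspondence {D D' : Diagram} (C : ℕ → ℕ → Prop) (hD : D.verts ≠ 0)
    (hD' : D'.verts ≠ 0)
    (fwd : ∀ c : ℕ → T, ColoredAll c D.verts →
      ∃ c', ColoredAll c' D'.verts ∧ ∀ a a', C a a' → c' a' = c a)
    (bwd : ∀ c' : ℕ → T, ColoredAll c' D'.verts →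
      ∃ c, ColoredAll c D.verts ∧ ∀ a a', C a a' → c' a' = c a)
    (det : ∀ R : T → T → Prop, OpCompatible R → ∀ c₁ c₂ : ℕ → T, ColoredAll c₁ D.verts →
      ColoredAll c₂ D.verts → (∀ a ∈ D.edges, ∀ a' ∈ D'.edges, C a a' → R (c₁ a) (c₂ a)) →
      ∀ a ∈ D.edges, R (c₁ a) (c₂ a))
    (det' : ∀ R : T → T → Prop, OpCompatible R → ∀ c₁ c₂ : ℕ → T, ColoredAll c₁ D'.verts →
      ColoredAll c₂ D'.verts → (∀ a ∈ D.edges, ∀ a' ∈ D'.edges, C a a' → R (c₁ a') (c₂ a')) →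
      ∀ a' ∈ D'.edges, R (c₁ a') (c₂ a')) :
    SameColorings T D D' := by
  let r (c : Coloring D T) (c' : Coloring D' T) : Prop :=
    ∀ (a : D.Edge) (a' : D'.Edge), C a.1 a'.1 → c'.1 a' = c.1 a
  have ex : ∀ c, ∃ c', r c c' := by
    intro c
    have := c.nonempty hD
    obtain ⟨k, hk, e⟩ := c.exists_extension
    obtain ⟨k', hk', h⟩ := fwd k hk
    exact ⟨Coloring.restrict k' hk', fun a a' haa' => (h _ _ haa').trans (e a).symm⟩
  have ex' : ∀ c', ∃ c, r c c' := by
    intro c'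
    have := c'.nonempty hD'
    obtain ⟨k', hk', e⟩ := c'.exists_extension
    obtain ⟨k, hk, h⟩ := bwd k' hk'
    exact ⟨Coloring.restrict k hk, fun a a' haa' => (e a').trans (h _ _ haa')⟩
  have uniq' : ∀ c c₁ c₂, r c c₁ → r c c₂ → c₁ = c₂ := by
    intro c c₁ c₂ h₁ h₂
    have := c.nonempty hD
    obtain ⟨k₁, hk₁, e₁⟩ := c₁.exists_extension
    obtain ⟨k₂, hk₂, e₂⟩ := c₂.exists_extension
    refine Subtype.ext (funext fun a' => ?_)
    rw [e₁, e₂]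
    refine det' _ opCompatible_eq k₁ k₂ hk₁ hk₂ (fun a ha a' ha' haa' => ?_) _ a'.2
    exact (e₁ ⟨a', ha'⟩).symm.trans ((h₁ ⟨a, ha⟩ ⟨a', ha'⟩ haa').trans
      ((h₂ ⟨a, ha⟩ ⟨a', ha'⟩ haa').symm.trans (e₂ ⟨a', ha'⟩)))
  have uniq : ∀ c₁ c₂ c', r c₁ c' → r c₂ c' → c₁ = c₂ := by
    intro c₁ c₂ c' h₁ h₂
    have := c'.nonempty hD'
    obtain ⟨k₁, hk₁, e₁⟩ := c₁.exists_extension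
    obtain ⟨k₂, hk₂, e₂⟩ := c₂.exists_extension
    refine Subtype.ext (funext fun a => ?_)
    rw [e₁, e₂]
    refine det _ opCompatible_eq k₁ k₂ hk₁ hk₂ (fun a ha a' ha' haa' => ?_) _ a.2
    exact (e₁ ⟨a, ha⟩).symm.trans ((h₁ ⟨a, ha⟩ ⟨a', ha'⟩ haa').symm.trans
      ((h₂ ⟨a, ha⟩ ⟨a', ha'⟩ haa').trans (e₂ ⟨a, ha⟩)))
  choose F hF using ex
  choose G hG using ex'
  refine ⟨⟨F, G, fun c => uniq _ _ _ (hG _) (hF c), fun c' => uniq' _ _ _ (hF _) (hG c')⟩,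
    fun c S hS => ?_⟩
  change _ ↔ ∀ a, (F c).1 a ∈ S
  have := c.nonempty hD
  obtain ⟨k, hk, e⟩ := c.exists_extension
  obtain ⟨k', hk', e'⟩ := (F c).exists_extension
  constructor
  · intro h a'
    rw [e']
    refine det' _ hS.opCompatible k' k' hk' hk' (fun a ha a' ha' haa' => ?_) _ a'.2
    rw [← e' ⟨a', ha'⟩, hF c ⟨a, ha⟩ ⟨a', ha'⟩ haa']
    exact h _
  · intro h a
    rw [e]
    refine det _ hS.opCompatible k k hk hk (fun a ha a' ha' haa' => ?_) _ a.2
    rw [← e ⟨a, ha⟩, ← hF c ⟨a, ha⟩ ⟨a', ha'⟩ haa']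
    exact h _

/-- The case of `sameColorings_of_correspondence` in which a part `L` of a diagram is replaced by `M`:
the set `I` contains the inner edges of both parts, which do not meet the rest `E` of the diagram. -/
theorem sameColorings_of_replacement {D D' : Diagram} {L M E : Multiset (Vertex ℕ)} (I : Set ℕ)
    (hD : D.verts = L + E) (hD' : D'.verts = M + E) (hL : L ≠ 0) (hM : M ≠ 0)
    (hI : ∀ a ∈ I, a ∉ E.bind Vertex.ins ∧ a ∉ E.bind Vertex.outs)
    (hLM : ∀ a ∉ I, a ∈ L.bind Vertex.ins ↔ a ∈ M.bind Vertex.ins)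
    (fwd : ∀ c : ℕ → T, ColoredAll c L → ∃ c', ColoredAll c' M ∧ ∀ a ∉ I, c' a = c a)
    (bwd : ∀ c : ℕ → T, ColoredAll c M → ∃ c', ColoredAll c' L ∧ ∀ a ∉ I, c' a = c a)
    (det : ∀ R : T → T → Prop, OpCompatible R → ∀ c₁ c₂ : ℕ → T, ColoredAll c₁ L →
      ColoredAll c₂ L → (∀ a ∈ L.bind Vertex.ins + L.bind Vertex.outs, a ∉ I → R (c₁ a) (c₂ a)) →
      ∀ a ∈ L.bind Vertex.ins, a ∈ I → R (c₁ a) (c₂ a))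
    (det' : ∀ R : T → T → Prop, OpCompatible R → ∀ c₁ c₂ : ℕ → T, ColoredAll c₁ M →
      ColoredAll c₂ M → (∀ a ∈ M.bind Vertex.ins + M.bind Vertex.outs, a ∉ I → R (c₁ a) (c₂ a)) →
      ∀ a ∈ M.bind Vertex.ins, a ∈ I → R (c₁ a) (c₂ a)) :
    SameColorings T D D' := by
  have carry : ∀ {c c' : ℕ → T}, (∀ a ∉ I, c' a = c a) → ColoredAll c E → ColoredAll c' E :=
    fun h hE => hE.congr (fun a ha => h a fun haI => (hI a haI).1 ha)
      fun a ha => h a fun haI => (hI a haI).2 ha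
  -- A property that `det` or `det'` passes from the boundary of a part to its inner edges holds for all
  -- edges once it holds for the common outer edges. This is used for both directions.
  have all : ∀ {D D' : Diagram} {L M : Multiset (Vertex ℕ)}, D.verts = L + E → D'.verts = M + E →
      (∀ a ∉ I, a ∈ L.bind Vertex.ins → a ∈ M.bind Vertex.ins) → ∀ P : ℕ → Prop,
      ((∀ a ∈ L.bind Vertex.ins + L.bind Vertex.outs, a ∉ I → P a) →
        ∀ a ∈ L.bind Vertex.ins, a ∈ I → P a) →
      (∀ a ∈ D.edges, a ∈ D'.edges → a ∉ I → P a) → ∀ a ∈ D.edges, P a := by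
    intro D D' L M hD hD' hLM P hP h
    have hins : D.edges = L.bind Vertex.ins + E.bind Vertex.ins := by
      rw [Diagram.edges, hD, Multiset.add_bind]
    have houts : D.edges = L.bind Vertex.outs + E.bind Vertex.outs := by
      rw [Diagram.edges, D.ins_eq_outs, hD, Multiset.add_bind]
    have hins' : D'.edges = M.bind Vertex.ins + E.bind Vertex.ins := by
      rw [Diagram.edges, hD', Multiset.add_bind]
    have outer : ∀ a ∈ D.edges, a ∉ I → P a := by
      intro a ha haI
      refine h a ha ?_ haI
      rw [hins']
      rw [hins] at ha
      exact Multiset.mem_add.2 ((Multiset.mem_add.1 ha).imp (hLM a haI) id)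
    intro a ha
    by_cases haI : a ∈ I
    · refine hP (fun b hb hbI => outer b ?_ hbI) a ?_ haI
      · rcases Multiset.mem_add.1 hb with hb | hb
        · exact hins ▸ Multiset.mem_add.2 (.inl hb)
        · exact houts ▸ Multiset.mem_add.2 (.inl hb)
      · exact (Multiset.mem_add.1 (hins ▸ ha)).resolve_right (hI a haI).1
    · exact outer a ha haI
  refine sameColorings_of_correspondence (fun a a' => a = a' ∧ a ∉ I) ?_ ?_ ?_ ?_ ?_ ?_
  · rw [hD]; simp [hL]
  · rw [hD']; simp [hM]
  · intro c hc
    rw [hD, coloredAll_add] at hc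
    obtain ⟨c', hc', h⟩ := fwd c hc.1
    exact ⟨c', hD' ▸ coloredAll_add.2 ⟨hc', carry h hc.2⟩, fun a a' ⟨e, ha⟩ => e ▸ h a ha⟩
  · intro c hc
    rw [hD', coloredAll_add] at hc
    obtain ⟨c', hc', h⟩ := bwd c hc.1
    exact ⟨c', hD ▸ coloredAll_add.2 ⟨hc', carry h hc.2⟩, fun a a' ⟨e, ha⟩ => e ▸ (h a ha).symm⟩
  · intro R hR c₁ c₂ h₁ h₂ h
    rw [hD, coloredAll_add] at h₁ h₂
    exact all hD hD' (fun a ha => (hLM a ha).1) _ (det R hR c₁ c₂ h₁.1 h₂.1)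
      fun a ha ha' haI => h a ha a ha' ⟨rfl, haI⟩
  · intro R hR c₁ c₂ h₁ h₂ h
    rw [hD', coloredAll_add] at h₁ h₂
    exact all hD' hD (fun a ha => (hLM a ha).2) _ (det' R hR c₁ c₂ h₁.1 h₂.1)
      fun a ha ha' haI => h a ha' a ha ⟨rfl, haI⟩

end Colorings

/-! ### Invariance of the colourings -/

section Invariance

variable {T : Type u} [Biquandle T]

theorem Diagram.nodup_outs (D : Diagram) : (D.verts.bind Vertex.outs).Nodup :=
  D.ins_eq_outs ▸ D.nodup_ins

theorem coloredAll_cons {c : ℕ → T} {v : Vertex ℕ} {M : Multiset (Vertex ℕ)} :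
    ColoredAll c (v ::ₘ M) ↔ v.Colored c ∧ ColoredAll c M :=
  Multiset.forall_mem_cons

theorem coloredAll_singleton {c : ℕ → T} {v : Vertex ℕ} : ColoredAll c {v} ↔ v.Colored c := by
  simp [ColoredAll]

theorem colored_cross {c : ℕ → T} {p : Bool} {o w : ℕ × ℕ} :
    (cross p o w).Colored c ↔ Crosses p (c o.1) (c o.2) (c w.1) (c w.2) := Iff.rfl

theorem colored_point {c : ℕ → T} {a b : ℕ} : (Vertex.point a b).Colored c ↔ c b = c a := Iff.rfl

theorem ins_cross (p : Bool) (o w : ℕ × ℕ) : (cross p o w).ins = {o.1, w.1} := rfl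

theorem outs_cross (p : Bool) (o w : ℕ × ℕ) : (cross p o w).outs = {o.2, w.2} := rfl

theorem ins_point (a b : ℕ) : (Vertex.point a b).ins = {a} := rfl

theorem outs_point (a b : ℕ) : (Vertex.point a b).outs = {b} := rfl

theorem coloredAll_triangle {c : ℕ → T} {side x y z : Bool} {t m b : Fin 3 → ℕ} :
    ColoredAll c (triangle side x y z t m b) ↔ TriangleColored side x y z (c ∘ t) (c ∘ m) (c ∘ b) := by
  cases side <;> cases x <;> cases y <;> cases z <;>
    simp [triangle, TriangleColored, colorLeg, leg, CrossColored, coloredAll_cons,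
      coloredAll_singleton, colored_cross]

/-- The edges entering a triangle are the same on both sides of the move and for all signs. -/
theorem ins_triangle (side x y z : Bool) (t m b : Fin 3 → ℕ) :
    (triangle side x y z t m b).bind Vertex.ins = {t 0, t 1, m 0, m 1, b 0, b 1} := by
  cases side <;> cases x <;> cases y <;> cases z <;>
    simp [triangle, leg, ins_cross, ← Multiset.singleton_add] <;> abel

theorem outs_triangle (side x y z : Bool) (t m b : Fin 3 → ℕ) :
    (triangle side x y z t m b).bind Vertex.outs = {t 1, t 2, m 1, m 2, b 1, b 2} := by
  cases side <;> cases x <;> cases y <;> cases z <;>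
    simp [triangle, leg, outs_cross, ← Multiset.singleton_add] <;> abel

theorem sameColorings_rename {D D' : Diagram} (g : Equiv.Perm ℕ)
    (h : D'.verts = D.verts.map (Vertex.map g)) : SameColorings T D D' := by
  have map_id : ∀ v : Vertex ℕ, v.map id = v := by rintro (_ | _) <;> rfl
  by_cases h0 : D.verts = 0
  · -- Without edges there are colourings even if `T` is empty, so this case is separate.
    have : D = D' := by
      cases D; cases D'
      simp_all
    exact this ▸ (sameColorings_equivalence T).refl D
  have mem : ∀ a, a ∈ D.edges ↔ g a ∈ D'.edges := by
    intro a
    have : D'.edges = D.edges.map g := by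
      simp only [Diagram.edges, h, Multiset.map_bind, Multiset.bind_map]
      refine Multiset.bind_congr fun v _ => ?_
      cases v <;> rfl
    simp [this]
  refine sameColorings_of_correspondence (fun a a' => a' = g a) h0 (by simp [h, h0]) ?_ ?_ ?_ ?_
  · intro c hc
    refine ⟨c ∘ g.symm, ?_, by rintro a _ rfl; simp⟩
    rw [h, coloredAll_map]
    simpa [Function.comp_assoc] using hc
  · intro c hc
    rw [h, coloredAll_map] at hc
    exact ⟨c ∘ g, hc, by rintro a _ rfl; rfl⟩
  · exact fun R _ c₁ c₂ _ _ k a ha => k a ha _ ((mem a).1 ha) rfl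
  · intro R _ c₁ c₂ _ _ k a ha
    refine k (g.symm a) ((mem _).2 ?_) a ha ?_ <;> simp [ha]

theorem sameColorings_unmark {D D' : Diagram} {a b : ℕ} (hab : a ≠ b) {E : Multiset (Vertex ℕ)}
    (h : D.verts = .point a b ::ₘ E)
    (h' : D'.verts = E.map (Vertex.map fun c => if c = b then a else c)) : SameColorings T D D' := by
  have hins : D.edges = a ::ₘ E.bind Vertex.ins := by
    rw [Diagram.edges, h, Multiset.cons_bind, ins_point, Multiset.singleton_add]
  have houts : D.edges = b ::ₘ E.bind Vertex.outs := by
    rw [Diagram.edges, D.ins_eq_outs, h, Multiset.cons_bind, outs_point, Multiset.singleton_add]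
  have hins' : D'.edges = (E.bind Vertex.ins).map fun c => if c = b then a else c := by
    simp only [Diagram.edges, h', Multiset.map_bind, Multiset.bind_map]
    refine Multiset.bind_congr fun v _ => ?_
    cases v <;> rfl
  have haD : a ∈ D.edges := by simp [hins]
  have hbD : b ∈ D.edges := by simp [houts]
  have hbE : b ∈ E.bind Vertex.ins := by
    rw [hins] at hbD
    exact (Multiset.mem_cons.1 hbD).resolve_left hab.symm
  have hE : E ≠ 0 := by rintro rfl; simp at hbE
  have haD' : a ∈ D'.edges := hins' ▸ Multiset.mem_map.2 ⟨b, hbE, if_pos rfl⟩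
  have mem : ∀ c ∈ D.edges, c ≠ b → c ∈ D'.edges := by
    intro c hc hcb
    rw [hins, Multiset.mem_cons] at hc
    rcases hc with rfl | hc
    · exact haD'
    · exact hins' ▸ Multiset.mem_map.2 ⟨c, hc, if_neg hcb⟩
  have mem' : ∀ c ∈ D'.edges, c ∈ D.edges ∧ c ≠ b := by
    intro c hc
    rw [hins', Multiset.mem_map] at hc
    obtain ⟨x, hx, rfl⟩ := hc
    split_ifs with hxb
    · exact ⟨haD, hab⟩
    · exact ⟨hins ▸ Multiset.mem_cons_of_mem hx, hxb⟩
  -- The edges of `D'` are those of `D` other than `b`, and `b` has the colour of `a`.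
  refine sameColorings_of_correspondence (fun c c' => c = c' ∧ c ≠ b) (by simp [h])
    (by simpa [h'] using hE) ?_ ?_ ?_ ?_
  · intro c hc
    rw [h] at hc
    refine ⟨c, ?_, by rintro x _ ⟨rfl, -⟩; rfl⟩
    have e : (c ∘ fun c => if c = b then a else c) = c := by
      funext x
      by_cases hx : x = b
      · have : c b = c a := hc _ (Multiset.mem_cons_self _ _)
        simp [hx, this]
      · simp [hx]
    rw [h', coloredAll_map, e]
    exact fun v hv => hc v (Multiset.mem_cons_of_mem hv)
  · intro c hc
    rw [h', coloredAll_map] at hc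
    refine ⟨c ∘ fun c => if c = b then a else c, ?_, by rintro x _ ⟨rfl, hx⟩; simp [hx]⟩
    rw [h, coloredAll_cons]
    exact ⟨by simp [colored_point], hc⟩
  · intro R _ c₁ c₂ h₁ h₂ k c hc
    rw [h, coloredAll_cons] at h₁ h₂
    by_cases hcb : c = b
    · have e₁ : c₁ b = c₁ a := h₁.1
      have e₂ : c₂ b = c₂ a := h₂.1
      rw [hcb, e₁, e₂]
      exact k a haD a haD' ⟨rfl, hab⟩
    · exact k c hc c (mem c hc hcb) ⟨rfl, hcb⟩
  · exact fun R _ c₁ c₂ _ _ k c hc => k c (mem' c hc).1 c hc ⟨rfl, (mem' c hc).2⟩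

variable [Finite T]

theorem sameColorings_kinkOver {D D' : Diagram} {p : Bool} {a l b : ℕ} {E : Multiset (Vertex ℕ)}
    (h : D.verts = cross p (a, l) (l, b) ::ₘ E) (h' : D'.verts = .point a b ::ₘ E) :
    SameColorings T D D' := by
  have hi := D.nodup_ins
  have ho := D.nodup_outs
  simp [h, ins_cross, outs_cross, not_or] at hi ho
  have hla : l ≠ a := fun e => hi.1.1 e.symm
  have hlb : b ≠ l := fun e => ho.1.1 e.symm
  refine sameColorings_of_replacement {l} (L := {cross p (a, l) (l, b)}) (M := {.point a b})
    (E := E) h h' (by simp) (by simp) (by simpa using ⟨hi.2.1, ho.1.2⟩) ?_ ?_ ?_ ?_ ?_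
  · simp +contextual [ins_cross, ins_point]
  · intro c hc
    exact ⟨c, coloredAll_singleton.2 (coloredAll_singleton.1 hc).kinkOver_eq, fun _ _ => rfl⟩
  · intro c hc
    rw [coloredAll_singleton, colored_point] at hc
    obtain ⟨x, hx⟩ := exists_kinkOver p (c a)
    refine ⟨Function.update c l x, ?_, fun y hy => Function.update_of_ne hy _ _⟩
    rw [coloredAll_singleton, colored_cross]
    simpa [hla.symm, hlb, hc] using hx
  · intro R hR c₁ c₂ h₁ h₂ k x _ hx
    rw [coloredAll_singleton] at h₁ h₂
    obtain rfl : x = l := hx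
    exact (hR.crosses h₁ h₂ (.inl (k a (by simp [ins_cross]) hla.symm))
      (.inr (k b (by simp [outs_cross]) hlb))).1.2
  · intro R hR c₁ c₂ h₁ h₂ k x hx hx'
    obtain rfl : x = l := hx'
    simp [ins_point, hla] at hx

theorem sameColorings_kinkUnder {D D' : Diagram} {p : Bool} {a l b : ℕ} {E : Multiset (Vertex ℕ)}
    (h : D.verts = cross p (l, b) (a, l) ::ₘ E) (h' : D'.verts = .point a b ::ₘ E) :
    SameColorings T D D' := by
  have hi := D.nodup_ins
  have ho := D.nodup_outs
  simp [h, ins_cross, outs_cross, not_or] at hi ho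
  have hla : l ≠ a := hi.1.1
  have hlb : b ≠ l := ho.1.1
  refine sameColorings_of_replacement {l} (L := {cross p (l, b) (a, l)}) (M := {.point a b})
    (E := E) h h' (by simp) (by simp) (by simpa using ⟨hi.1.2, ho.2.1⟩) ?_ ?_ ?_ ?_ ?_
  · simp +contextual [ins_cross, ins_point]
  · intro c hc
    exact ⟨c, coloredAll_singleton.2 (coloredAll_singleton.1 hc).kinkUnder_eq, fun _ _ => rfl⟩
  · intro c hc
    rw [coloredAll_singleton, colored_point] at hc
    obtain ⟨x, hx⟩ := exists_kinkUnder p (c a)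
    refine ⟨Function.update c l x, ?_, fun y hy => Function.update_of_ne hy _ _⟩
    rw [coloredAll_singleton, colored_cross]
    simpa [hla.symm, hlb, hc] using hx
  · intro R hR c₁ c₂ h₁ h₂ k x _ hx
    rw [coloredAll_singleton] at h₁ h₂
    obtain rfl : x = l := hx
    exact (hR.crosses h₁ h₂ (.inr (k b (by simp [outs_cross]) hlb))
      (.inl (k a (by simp [ins_cross]) hla.symm))).1.1
  · intro R hR c₁ c₂ h₁ h₂ k x hx hx'
    obtain rfl : x = l := hx'
    simp [ins_point, hla] at hx

theorem sameColorings_parallel {D D' : Diagram} {p : Bool} {a e b c f d : ℕ}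
    {E : Multiset (Vertex ℕ)}
    (h : D.verts = cross p (a, e) (c, f) ::ₘ cross (!p) (e, b) (f, d) ::ₘ E)
    (h' : D'.verts = .point a b ::ₘ .point c d ::ₘ E) : SameColorings T D D' := by
  have hi := D.nodup_ins
  have ho := D.nodup_outs
  simp [h, ins_cross, outs_cross, not_or] at hi ho
  obtain ⟨hef, hae, hce, haf, hcf, hbe, hde, hbf, hdf⟩ : e ≠ f ∧ a ≠ e ∧ c ≠ e ∧ a ≠ f ∧ c ≠ f ∧
      b ≠ e ∧ d ≠ e ∧ b ≠ f ∧ d ≠ f := by grind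
  refine sameColorings_of_replacement {e, f}
    (L := {cross p (a, e) (c, f), cross (!p) (e, b) (f, d)}) (M := {.point a b, .point c d})
    (E := E) (by simp [h]) (by simp [h']) (by simp) (by simp) ?_ ?_ ?_ ?_ ?_ ?_
  · simp
    grind
  · simp +contextual [ins_cross, ins_point, not_or]
  · intro k hk
    simp only [Multiset.insert_eq_cons, coloredAll_cons, coloredAll_singleton] at hk ⊢
    exact ⟨k, hk.1.parallel_eq hk.2, fun _ _ => rfl⟩
  · intro k hk
    simp only [Multiset.insert_eq_cons, coloredAll_cons, coloredAll_singleton, colored_point] at hk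
    obtain ⟨x, y, hxy⟩ := exists_crosses_overIn_underIn p (k a) (k c)
    refine ⟨Function.update (Function.update k e x) f y, ?_, fun z hz => ?_⟩
    · simp only [Multiset.insert_eq_cons, coloredAll_cons, coloredAll_singleton, colored_cross,
        crosses_not_iff]
      simpa [hae, hce, haf, hcf, hbe, hde, hbf, hdf, hef, hk] using hxy
    · rw [Set.mem_insert_iff, Set.mem_singleton_iff, not_or] at hz
      rw [Function.update_of_ne hz.2, Function.update_of_ne hz.1]
  · intro R hR c₁ c₂ h₁ h₂ k x _ hx
    simp only [Multiset.insert_eq_cons, coloredAll_cons, coloredAll_singleton] at h₁ h₂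
    have r := hR.crosses h₁.1 h₂.1 (.inl (k a (by simp [ins_cross]) (by simp [hae, haf])))
      (.inl (k c (by simp [ins_cross]) (by simp [hce, hcf])))
    rcases hx with rfl | rfl
    · exact r.1.2
    · exact r.2.2
  · intro R hR c₁ c₂ h₁ h₂ k x hx hx'
    rcases hx' with rfl | rfl
    · simp [ins_point, hae.symm, hce.symm] at hx
    · simp [ins_point, haf.symm, hcf.symm] at hx

theorem sameColorings_antiparallel {D D' : Diagram} {p : Bool} {a e b c f d : ℕ}
    {E : Multiset (Vertex ℕ)}
    (h : D.verts = cross p (a, e) (f, d) ::ₘ cross (!p) (e, b) (c, f) ::ₘ E)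
    (h' : D'.verts = .point a b ::ₘ .point c d ::ₘ E) : SameColorings T D D' := by
  have hi := D.nodup_ins
  have ho := D.nodup_outs
  simp [h, ins_cross, outs_cross, not_or] at hi ho
  obtain ⟨hef, hae, hce, haf, hcf, hbe, hde, hbf, hdf⟩ : e ≠ f ∧ a ≠ e ∧ c ≠ e ∧ a ≠ f ∧ c ≠ f ∧
      b ≠ e ∧ d ≠ e ∧ b ≠ f ∧ d ≠ f := by grind
  refine sameColorings_of_replacement {e, f}
    (L := {cross p (a, e) (f, d), cross (!p) (e, b) (c, f)}) (M := {.point a b, .point c d})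
    (E := E) (by simp [h]) (by simp [h']) (by simp) (by simp) ?_ ?_ ?_ ?_ ?_ ?_
  · simp
    grind
  · simp +contextual [ins_cross, ins_point, not_or]
  · intro k hk
    simp only [Multiset.insert_eq_cons, coloredAll_cons, coloredAll_singleton] at hk ⊢
    exact ⟨k, hk.1.antiparallel_eq hk.2, fun _ _ => rfl⟩
  · intro k hk
    simp only [Multiset.insert_eq_cons, coloredAll_cons, coloredAll_singleton, colored_point] at hk
    obtain ⟨x, y, hxy⟩ := exists_crosses_overIn_underOut p (k a) (k d)
    refine ⟨Function.update (Function.update k e x) f y, ?_, fun z hz => ?_⟩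
    · simp only [Multiset.insert_eq_cons, coloredAll_cons, coloredAll_singleton, colored_cross,
        crosses_not_iff]
      simpa [hae, hce, haf, hcf, hbe, hde, hbf, hdf, hef, hk] using hxy
    · rw [Set.mem_insert_iff, Set.mem_singleton_iff, not_or] at hz
      rw [Function.update_of_ne hz.2, Function.update_of_ne hz.1]
  · intro R hR c₁ c₂ h₁ h₂ k x _ hx
    simp only [Multiset.insert_eq_cons, coloredAll_cons, coloredAll_singleton] at h₁ h₂
    have r := hR.crosses h₁.1 h₂.1 (.inl (k a (by simp [ins_cross]) (by simp [hae, haf])))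
      (.inr (k d (by simp [outs_cross]) (by simp [hde, hdf])))
    rcases hx with rfl | rfl
    · exact r.1.2
    · exact r.2.1
  · intro R hR c₁ c₂ h₁ h₂ k x hx hx'
    rcases hx' with rfl | rfl
    · simp [ins_point, hae.symm, hce.symm] at hx
    · simp [ins_point, haf.symm, hcf.symm] at hx

theorem sameColorings_slide {D D' : Diagram} {x y z : Bool} {t m b : Fin 3 → ℕ}
    {E : Multiset (Vertex ℕ)} (h : D.verts = triangle true x y z t m b + E)
    (h' : D'.verts = triangle false x y z t m b + E) : SameColorings T D D' := by
  have hi := D.nodup_ins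
  have ho := D.nodup_outs
  rw [h, Multiset.add_bind, ins_triangle] at hi
  rw [h, Multiset.add_bind, outs_triangle] at ho
  simp [not_or] at hi ho
  -- The outer edges of the strands differ from the inner ones.
  have hI : ∀ e : Fin 3 → ℕ, e = t ∨ e = m ∨ e = b → ∀ i : Fin 3, i ≠ 1 →
      e i ≠ t 1 ∧ e i ≠ m 1 ∧ e i ≠ b 1 := by
    rintro e (rfl | rfl | rfl) i hi1 <;> fin_cases i <;> simp at hi1 ⊢ <;> grind
  have carry : ∀ (side : Bool) (c : ℕ → T), ColoredAll c (triangle side x y z t m b) →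
      ∃ c', ColoredAll c' (triangle (!side) x y z t m b) ∧
        ∀ a ∉ ({t 1, m 1, b 1} : Set ℕ), c' a = c a := by
    intro side c hc
    rw [coloredAll_triangle] at hc
    obtain ⟨t', m', b', k⟩ := hc.exists_other_side
    refine ⟨Function.update (Function.update (Function.update c (t 1) t') (m 1) m') (b 1) b', ?_, ?_⟩
    · rw [coloredAll_triangle]
      convert k using 1 <;> funext i <;> fin_cases i <;>
        simp [Function.update_apply] <;> grind
    · intro a ha
      simp only [Set.mem_insert_iff, Set.mem_singleton_iff, not_or] at ha
      rw [Function.update_of_ne ha.2.2, Function.update_of_ne ha.2.1, Function.update_of_ne ha.1]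
  have det : ∀ (side : Bool) (R : T → T → Prop), OpCompatible R → ∀ c₁ c₂ : ℕ → T,
      ColoredAll c₁ (triangle side x y z t m b) → ColoredAll c₂ (triangle side x y z t m b) →
      (∀ a ∈ (triangle side x y z t m b).bind Vertex.ins +
        (triangle side x y z t m b).bind Vertex.outs, a ∉ ({t 1, m 1, b 1} : Set ℕ) →
          R (c₁ a) (c₂ a)) →
      ∀ a ∈ (triangle side x y z t m b).bind Vertex.ins, a ∈ ({t 1, m 1, b 1} : Set ℕ) →
        R (c₁ a) (c₂ a) := by
    intro side R hR c₁ c₂ h₁ h₂ k a _ ha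
    rw [coloredAll_triangle] at h₁ h₂
    rw [ins_triangle, outs_triangle] at k
    have r : ∀ e : Fin 3 → ℕ, e = t ∨ e = m ∨ e = b →
        R (c₁ (e 0)) (c₂ (e 0)) ∧ R (c₁ (e 2)) (c₂ (e 2)) := by
      intro e he
      refine ⟨k _ ?_ (by simpa using hI e he 0 (by decide)),
        k _ ?_ (by simpa using hI e he 2 (by decide))⟩ <;> rcases he with rfl | rfl | rfl <;> simp
    have s := hR.triangleColored h₁ h₂ (r t (by simp)) (r m (by simp)) (r b (by simp))
    rcases ha with rfl | rfl | rfl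
    · exact s.1
    · exact s.2.1
    · exact s.2.2
  refine sameColorings_of_replacement {t 1, m 1, b 1} h h' (by simp [triangle]) (by simp [triangle])
    ?_ ?_ (carry true) (carry false) (det true) (det false)
  · simp
    grind
  · simp [ins_triangle]

/-- Every move between diagrams gives a bijection of their colourings. -/
theorem Move.sameColorings {D D' : Diagram} (h : Move D D') : SameColorings T D D' := by
  cases h with
  | rename g h => exact sameColorings_rename g h
  | unmark a b hab E h h' => exact sameColorings_unmark hab h h'
  | kinkOver p a l b E h h' => exact sameColorings_kinkOver h h'
  | kinkUnder p a l b E h h' => exact sameColorings_kinkUnder h h'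
  | parallel p a e b c f d E h h' => exact sameColorings_parallel h h'
  | antiparallel p a e b c f d E h h' => exact sameColorings_antiparallel h h'
  | slide x y z t m b E h h' => exact sameColorings_slide h h'

theorem SameLink.sameColorings {D D' : Diagram} (h : SameLink D D') : SameColorings T D D' :=
  (sameColorings_equivalence T).eqvGen_iff.1 (h.mono fun _ _ => Move.sameColorings)

end Invariance

/-! ### Homomorphisms from the knot biquandle as colourings -/

section KnotBiquandle

variable {T : Type u} [Biquandle T] {D : Diagram}

theorem OpClosed.of_op [Finite T] {S : Set T} (hS : OpClosed S) (i : Fin 4) {a b : T}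
    (ha : Biquandle.op i a b ∈ S) (hb : b ∈ S) : a ∈ S :=
  hS.opCompatible.of_op i (a' := a) (b' := b) ha hb

/-- The colouring by the images of the generators. -/
def BiquandleHom.coloring (f : BiquandleHom D.B T) : Coloring D T := by
  let mk : BWord D.Edge → D.B := Quotient.mk (BWord.setoid D.BRel)
  refine ⟨fun a => f.toFun (mk (.gen a)), fun v hv => ?_⟩
  match v, hv with
  | .crossing true oi oo ui uo, hv =>
    exact ⟨(congrArg f.toFun (Quotient.sound (.rel (.posUnder oi oo ui uo hv)))).trans
      (f.map_up (mk (.gen ui)) (mk (.gen oi))),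
      (congrArg f.toFun (Quotient.sound (.rel (.posOver oi oo ui uo hv)))).trans
      (f.map_down (mk (.gen oi)) (mk (.gen ui)))⟩
  | .crossing false oi oo ui uo, hv =>
    exact ⟨(congrArg f.toFun (Quotient.sound (.rel (.negUnder oi oo ui uo hv)))).trans
      (f.map_upBar (mk (.gen ui)) (mk (.gen oi))),
      (congrArg f.toFun (Quotient.sound (.rel (.negOver oi oo ui uo hv)))).trans
      (f.map_downBar (mk (.gen oi)) (mk (.gen ui)))⟩
  | .point a b, hv => exact congrArg f.toFun (Quotient.sound (.rel (.point a b hv)))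

variable [Finite T]

/-- The image of a homomorphism is generated by the colours: division by `up` and `upBar`, which occurs
in words, does not leave a closed subset of a finite biquandle. -/
theorem BiquandleHom.range_subset_iff (f : BiquandleHom D.B T) {S : Set T} (hS : OpClosed S) :
    Set.range f.toFun ⊆ S ↔ ∀ a, f.coloring.1 a ∈ S := by
  refine ⟨fun h a => h ⟨_, rfl⟩, ?_⟩
  rintro h _ ⟨q, rfl⟩
  let mk : BWord D.Edge → D.B := Quotient.mk (BWord.setoid D.BRel)
  induction q using Quotient.inductionOn with
  | h w =>
    change f.toFun (mk w) ∈ S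
    induction w with
    | gen x => exact h x
    | up a b iha ihb => exact (f.map_up (mk a) (mk b)).symm ▸ hS 1 iha ihb
    | upBar a b iha ihb => exact (f.map_upBar (mk a) (mk b)).symm ▸ hS 0 iha ihb
    | down a b iha ihb => exact (f.map_down (mk a) (mk b)).symm ▸ hS 3 iha ihb
    | downBar a b iha ihb => exact (f.map_downBar (mk a) (mk b)).symm ▸ hS 2 iha ihb
    | divUp a b iha ihb =>
      have e : mk a = Biquandle.up (mk (.divUp a b)) (mk b) :=
        (Quotient.sound (BWord.Eqv.up_divUp a b)).symm
      rw [e, f.map_up] at iha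
      exact hS.of_op 1 iha ihb
    | divUpBar a b iha ihb =>
      have e : mk a = Biquandle.upBar (mk (.divUpBar a b)) (mk b) :=
        (Quotient.sound (BWord.Eqv.upBar_divUpBar a b)).symm
      rw [e, f.map_upBar] at iha
      exact hS.of_op 0 iha ihb

theorem BiquandleHom.coloring_injective :
    Function.Injective (BiquandleHom.coloring : BiquandleHom D.B T → Coloring D T) := by
  intro f g h
  have hgen : ∀ a, f.coloring.1 a = g.coloring.1 a := fun a => by rw [h]
  ext q
  let mk : BWord D.Edge → D.B := Quotient.mk (BWord.setoid D.BRel)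
  induction q using Quotient.inductionOn with
  | h w =>
    change f.toFun (mk w) = g.toFun (mk w)
    induction w with
    | gen x => exact hgen x
    | up a b iha ihb =>
      have e : mk (.up a b) = Biquandle.up (mk a) (mk b) := rfl
      rw [e, f.map_up, g.map_up, iha, ihb]
    | upBar a b iha ihb =>
      have e : mk (.upBar a b) = Biquandle.upBar (mk a) (mk b) := rfl
      rw [e, f.map_upBar, g.map_upBar, iha, ihb]
    | down a b iha ihb =>
      have e : mk (.down a b) = Biquandle.down (mk a) (mk b) := rfl
      rw [e, f.map_down, g.map_down, iha, ihb]
    | downBar a b iha ihb =>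
      have e : mk (.downBar a b) = Biquandle.downBar (mk a) (mk b) := rfl
      rw [e, f.map_downBar, g.map_downBar, iha, ihb]
    | divUp a b iha ihb =>
      have e : mk a = Biquandle.up (mk (.divUp a b)) (mk b) :=
        (Quotient.sound (BWord.Eqv.up_divUp a b)).symm
      rw [e, f.map_up, g.map_up, ihb] at iha
      exact (Biquandle.op_bijective 1 _).1 iha
    | divUpBar a b iha ihb =>
      have e : mk a = Biquandle.upBar (mk (.divUpBar a b)) (mk b) :=
        (Quotient.sound (BWord.Eqv.upBar_divUpBar a b)).symm
      rw [e, f.map_upBar, g.map_upBar, ihb] at iha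
      exact (Biquandle.op_bijective 0 _).1 iha

/-- The inverse of the permutation `op i (-, b)` of a finite biquandle. -/
noncomputable def Biquandle.opInv (i : Fin 4) (a b : T) : T :=
  (Equiv.ofBijective _ (Biquandle.op_bijective i b)).symm a

theorem Biquandle.op_opInv (i : Fin 4) (a b : T) : Biquandle.op i (Biquandle.opInv i a b) b = a :=
  (Equiv.ofBijective _ (Biquandle.op_bijective i b)).apply_symm_apply a

theorem Biquandle.opInv_op (i : Fin 4) (a b : T) : Biquandle.opInv i (Biquandle.op i a b) b = a :=
  (Equiv.ofBijective _ (Biquandle.op_bijective i b)).symm_apply_apply a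

/-- The value of a biquandle word in a finite biquandle. -/
noncomputable def BWord.eval {X : Type v} (c : X → T) : BWord X → T
  | .gen x => c x
  | .up a b => Biquandle.up (a.eval c) (b.eval c)
  | .upBar a b => Biquandle.upBar (a.eval c) (b.eval c)
  | .down a b => Biquandle.down (a.eval c) (b.eval c)
  | .downBar a b => Biquandle.downBar (a.eval c) (b.eval c)
  | .divUp a b => Biquandle.opInv 1 (a.eval c) (b.eval c)
  | .divUpBar a b => Biquandle.opInv 0 (a.eval c) (b.eval c)

theorem BWord.Eqv.eval_eq {X : Type v} {R : BWord X → BWord X → Prop} {c : X → T}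
    (hR : ∀ a b, R a b → a.eval c = b.eval c) {a b : BWord X} (h : BWord.Eqv R a b) :
    a.eval c = b.eval c := by
  induction h with
  | rel h => exact hR _ _ h
  | refl => rfl
  | symm _ ih => exact ih.symm
  | trans _ _ ih ih' => exact ih.trans ih'
  | up _ _ ih ih' | upBar _ _ ih ih' | down _ _ ih ih' | downBar _ _ ih ih' | divUp _ _ ih ih'
  | divUpBar _ _ ih ih' => simp only [BWord.eval, ih, ih']
  | inv_up a b => exact Biquandle.inv_up _ _
  | inv_down a b => exact Biquandle.inv_down _ _
  | inv_upBar a b => exact Biquandle.inv_upBar _ _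
  | inv_downBar a b => exact Biquandle.inv_downBar _ _
  | up_divUp a b => exact Biquandle.op_opInv 1 _ _
  | divUp_up a b => exact Biquandle.opInv_op 1 _ _
  | upBar_divUpBar a b => exact Biquandle.op_opInv 0 _ _
  | divUpBar_upBar a b => exact Biquandle.opInv_op 0 _ _
  | braid_up a b c => exact Biquandle.braid_up _ _ _
  | braid_down a b c => exact Biquandle.braid_down _ _ _
  | braid_mid a b c => exact Biquandle.braid_mid _ _ _
  | braid_upBar a b c => exact Biquandle.braid_upBar _ _ _
  | braid_downBar a b c => exact Biquandle.braid_downBar _ _ _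
  | braid_midBar a b c => exact Biquandle.braid_midBar _ _ _
  | kink a => exact (eq_down_iff_eq_up _ _).2 (Biquandle.op_opInv 1 _ _).symm

theorem BiquandleHom.coloring_surjective :
    Function.Surjective (BiquandleHom.coloring : BiquandleHom D.B T → Coloring D T) := by
  rintro ⟨c, hc⟩
  have hR : ∀ a b, D.BRel a b → a.eval c = b.eval c := by
    intro a b h
    cases h with
    | posUnder oi oo ui uo h => exact (hc (.crossing true oi oo ui uo) h).1
    | posOver oi oo ui uo h => exact (hc (.crossing true oi oo ui uo) h).2
    | negUnder oi oo ui uo h => exact (hc (.crossing false oi oo ui uo) h).1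
    | negOver oi oo ui uo h => exact (hc (.crossing false oi oo ui uo) h).2
    | point a b h => exact hc (.point a b) h
  refine ⟨⟨Quotient.lift (BWord.eval c) fun _ _ h => BWord.Eqv.eval_eq hR h, ?_, ?_, ?_, ?_⟩, rfl⟩ <;>
  · rintro ⟨a⟩ ⟨b⟩
    rfl

end KnotBiquandle

/-! ### Homomorphisms from the knot quandle as colourings -/

section KnotQuandle

/-- A quandle as a biquandle, in which the colour of a strand does not change when it passes over
another strand. -/
@[reducible]
def biquandleOfQuandle (T : Type u) [Quandle T] : Biquandle T where
  up a b := b ◃ a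
  upBar a b := b ◃⁻¹ a
  down a _ := a
  downBar a _ := a
  inv_up a b := (Rack.left_inv b a).symm
  inv_down _ _ := rfl
  inv_upBar a b := (Rack.right_inv b a).symm
  inv_downBar _ _ := rfl
  exists_bar a b := ⟨b ◃ a, rfl, (Rack.left_inv b a).symm, rfl⟩
  exists_unbar a b := ⟨b ◃⁻¹ a, rfl, (Rack.right_inv b a).symm, rfl⟩
  braid_up _ _ _ := Shelf.self_distrib
  braid_down _ _ _ := rfl
  braid_mid _ _ _ := rfl
  braid_upBar _ _ _ := Rack.self_distrib_inv
  braid_downBar _ _ _ := rfl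
  braid_midBar _ _ _ := rfl
  kink a := ⟨a, ⟨rfl, Quandle.fix.symm⟩, fun _ h => h.1⟩
  kinkBar a := ⟨a, ⟨Quandle.fix_inv.symm, rfl⟩, fun _ h => h.2.symm⟩

attribute [local instance] biquandleOfQuandle

variable {T : Type u} [Quandle T] {D : Diagram}

theorem map_invAct {P : Type v} [Quandle P] (f : P →◃ T) (x y : P) : f (x ◃⁻¹ y) = f x ◃⁻¹ f y := by
  rw [← Rack.left_cancel (f x), ← f.map_act, Rack.right_inv, Rack.right_inv]

/-- The colouring by the images of the generators. -/
def quandleHomColoring (f : D.Q →◃ T) : Coloring D T := by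
  let mk : QWord D.Edge → D.Q := Quotient.mk (QWord.setoid D.QRel)
  refine ⟨fun a => f (mk (.gen a)), fun v hv => ?_⟩
  match v, hv with
  | .crossing true oi oo ui uo, hv =>
    exact ⟨(congrArg f (Quotient.sound (.rel (.pos oi oo ui uo hv)))).trans
      (f.map_act (x := mk (.gen oi)) (y := mk (.gen ui))),
      congrArg f (Quotient.sound (.rel (.overStrand true oi oo ui uo hv)))⟩
  | .crossing false oi oo ui uo, hv =>
    exact ⟨(congrArg f (Quotient.sound (.rel (.neg oi oo ui uo hv)))).trans
      (map_invAct f (mk (.gen oi)) (mk (.gen ui))),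
      congrArg f (Quotient.sound (.rel (.overStrand false oi oo ui uo hv)))⟩
  | .point a b, hv => exact congrArg f (Quotient.sound (.rel (.point a b hv)))

/-- The closed subsets of a quandle, as a biquandle, are its subquandles. -/
theorem opClosed_iff_of_quandle {S : Set T} :
    OpClosed S ↔ ∀ a ∈ S, ∀ b ∈ S, a ◃ b ∈ S ∧ a ◃⁻¹ b ∈ S := by
  constructor
  · exact fun h a ha b hb => ⟨h 1 hb ha, h 0 hb ha⟩
  · intro h i a b ha hb
    fin_cases i
    · exact (h b hb a ha).2
    · exact (h b hb a ha).1
    · exact ha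
    · exact ha

/-- The image of a homomorphism is generated by the colours. -/
theorem quandleHom_range_subset_iff (f : D.Q →◃ T) {S : Set T} (hS : OpClosed S) :
    Set.range f ⊆ S ↔ ∀ a, (quandleHomColoring f).1 a ∈ S := by
  refine ⟨fun h a => h ⟨_, rfl⟩, ?_⟩
  rintro h _ ⟨q, rfl⟩
  let mk : QWord D.Edge → D.Q := Quotient.mk (QWord.setoid D.QRel)
  induction q using Quotient.inductionOn with
  | h w =>
    change f (mk w) ∈ S
    induction w with
    | gen x => exact h x
    | tri a b iha ihb => exact (f.map_act (x := mk b) (y := mk a)).symm ▸ hS 1 iha ihb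
    | triInv a b iha ihb => exact (map_invAct f (mk b) (mk a)).symm ▸ hS 0 iha ihb

theorem quandleHomColoring_injective :
    Function.Injective (quandleHomColoring : (D.Q →◃ T) → Coloring D T) := by
  intro f g h
  have hgen : ∀ a, (quandleHomColoring f).1 a = (quandleHomColoring g).1 a := fun a => by rw [h]
  ext q
  let mk : QWord D.Edge → D.Q := Quotient.mk (QWord.setoid D.QRel)
  induction q using Quotient.inductionOn with
  | h w =>
    change f (mk w) = g (mk w)
    induction w with
    | gen x => exact hgen x
    | tri a b iha ihb =>
      have e : mk (.tri a b) = mk b ◃ mk a := rfl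
      rw [e, f.map_act, g.map_act, iha, ihb]
    | triInv a b iha ihb =>
      have e : mk (.triInv a b) = mk b ◃⁻¹ mk a := rfl
      rw [e, map_invAct, map_invAct, iha, ihb]

/-- The value of a quandle word in a quandle. -/
def QWord.eval {X : Type v} (c : X → T) : QWord X → T
  | .gen x => c x
  | .tri a b => b.eval c ◃ a.eval c
  | .triInv a b => b.eval c ◃⁻¹ a.eval c

theorem QWord.Eqv.eval_eq {X : Type v} {R : QWord X → QWord X → Prop} {c : X → T}
    (hR : ∀ a b, R a b → a.eval c = b.eval c) {a b : QWord X} (h : QWord.Eqv R a b) :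
    a.eval c = b.eval c := by
  induction h with
  | rel h => exact hR _ _ h
  | refl => rfl
  | symm _ ih => exact ih.symm
  | trans _ _ ih ih' => exact ih.trans ih'
  | tri _ _ ih ih' | triInv _ _ ih ih' => simp only [QWord.eval, ih, ih']
  | idem a => exact Quandle.fix
  | cancel a b => exact Rack.left_inv _ _
  | cancel' a b => exact Rack.right_inv _ _
  | distrib a b c => exact Shelf.self_distrib

theorem quandleHomColoring_surjective :
    Function.Surjective (quandleHomColoring : (D.Q →◃ T) → Coloring D T) := by
  rintro ⟨c, hc⟩
  have hR : ∀ a b, D.QRel a b → a.eval c = b.eval c := by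
    intro a b h
    cases h with
    | overStrand p oi oo ui uo h => cases p <;> exact (hc (.crossing _ oi oo ui uo) h).2
    | pos oi oo ui uo h => exact (hc (.crossing true oi oo ui uo) h).1
    | neg oi oo ui uo h => exact (hc (.crossing false oi oo ui uo) h).1
    | point a b h => exact hc (.point a b) h
  refine ⟨⟨Quotient.lift (QWord.eval c) fun _ _ h => QWord.Eqv.eval_eq hR h, ?_⟩, rfl⟩
  rintro ⟨b⟩ ⟨a⟩
  rfl

end KnotQuandle

/-! ### Invariance of the polynomials -/

section Polynomials

theorem values_comp_equiv {I J : Type*} [Finite I] [Finite J] {M : Type u} (e : I ≃ J) (F : J → M) :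
    values (F ∘ e) = values F := by
  unfold values
  let := Fintype.ofFinite I
  let := Fintype.ofFinite J
  rw [← Finset.map_univ_equiv e, Finset.map_val, Multiset.map_map]
  rfl

theorem powerSum_comp_equiv {I J : Type*} [Finite I] [Finite J] {M : Type u} [AddCommMonoid M]
    (e : I ≃ J) (F : J → M) : powerSum (F ∘ e) = powerSum F :=
  finsum_comp_equiv e (f := fun j => AddMonoidAlgebra.single (F j) (1 : ℤ))

theorem card_values {I : Type*} [Finite I] {M : Type u} (F : I → M) :
    Multiset.card (values F) = Nat.card I := by
  let := Fintype.ofFinite I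
  rw [values, Multiset.card_map, Nat.card_eq_fintype_card]
  rfl

theorem setQOne_powerSum {I : Type*} [Finite I] {M : Type u} [AddCommMonoid M] (F : I → M) :
    setQOne (powerSum F) = Nat.card I := by
  let := Fintype.ofFinite I
  rw [powerSum, finsum_eq_sum_of_fintype, map_sum]
  simp [setQOne, AddMonoidAlgebra.lift_single]

/-- If homomorphisms correspond to colourings and their images are the closed sets generated by the
colours, then a bijection of colourings as in `SameColorings` gives a bijection of homomorphisms that
preserves images. -/
theorem SameColorings.exists_equiv {T : Type u} [Biquandle T] {D D' : Diagram}
    (h : SameColorings T D D') {X X' : Type*} {k : X → Coloring D T} {k' : X' → Coloring D' T}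
    (hk : Function.Bijective k) (hk' : Function.Bijective k') {im : X → Set T} {im' : X' → Set T}
    (him : ∀ f, OpClosed (im f)) (him' : ∀ f, OpClosed (im' f))
    (hsub : ∀ f S, OpClosed S → (im f ⊆ S ↔ ∀ a, (k f).1 a ∈ S))
    (hsub' : ∀ f S, OpClosed S → (im' f ⊆ S ↔ ∀ a, (k' f).1 a ∈ S)) :
    ∃ e : X ≃ X', ∀ f, im' (e f) = im f := by
  obtain ⟨e, he⟩ := h
  let e' := ((Equiv.ofBijective k hk).trans e).trans (Equiv.ofBijective k' hk').symm
  have hke : ∀ f, k' (e' f) = e (k f) := fun f => (Equiv.ofBijective k' hk').apply_symm_apply _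
  have key : ∀ f S, OpClosed S → (im f ⊆ S ↔ im' (e' f) ⊆ S) := fun f S hS => by
    rw [hsub f S hS, hsub' _ S hS, hke, he _ S hS]
  exact ⟨e', fun f => ((key f _ (him f)).1 subset_rfl).antisymm
    ((key f _ (him' _)).2 subset_rfl)⟩

theorem SameLink.exists_quandleHom_equiv {D D' : Diagram} (h : SameLink D D') (T : Type u)
    [Quandle T] [Finite T] :
    ∃ e : (D.Q →◃ T) ≃ (D'.Q →◃ T), ∀ f, Set.range (e f) = Set.range f := by
  let := biquandleOfQuandle T
  have him : ∀ {D : Diagram} (f : D.Q →◃ T), OpClosed (Set.range f) := fun f =>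
    opClosed_iff_of_quandle.2 fun _ ha _ hb =>
      ⟨(Subquandle.image f).act_mem ha hb, (Subquandle.image f).invAct_mem ha hb⟩
  exact h.sameColorings.exists_equiv ⟨quandleHomColoring_injective, quandleHomColoring_surjective⟩
    ⟨quandleHomColoring_injective, quandleHomColoring_surjective⟩ him him
    (fun f _ => quandleHom_range_subset_iff f) fun f _ => quandleHom_range_subset_iff f

theorem SameLink.exists_biquandleHom_equiv {D D' : Diagram} (h : SameLink D D') (T : Type u)
    [Biquandle T] [Finite T] :
    ∃ e : BiquandleHom D.B T ≃ BiquandleHom D'.B T,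
      ∀ f, Set.range (e f).toFun = Set.range f.toFun := by
  have him : ∀ {D : Diagram} (f : BiquandleHom D.B T), OpClosed (Set.range f.toFun) :=
    fun f i _ _ ha hb => (Subbiquandle.image f).op_mem i ha hb
  exact h.sameColorings.exists_equiv
    ⟨BiquandleHom.coloring_injective, BiquandleHom.coloring_surjective⟩
    ⟨BiquandleHom.coloring_injective, BiquandleHom.coloring_surjective⟩ him him
    (fun f _ => f.range_subset_iff) fun f _ => f.range_subset_iff

theorem sqp_congr {T : Type u} [Quandle T] [Finite T] (m n : ℤ) {S S' : Subquandle T}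
    (h : S.carrier = S'.carrier) : sqp m n S = sqp m n S' := by
  rw [sqp, sqp, h]

theorem sbp_congr {T : Type u} [Biquandle T] [Finite T] (m n : ℤ) {S S' : Subbiquandle T}
    (h : S.carrier = S'.carrier) : sbp m n S = sbp m n S' := by
  rw [sbp, sbp, h]

end Polynomials

end LinkPoly

open LinkPoly in
theorem mainTheorem4 (m n : ℤ) :
    (∀ (T : Type u) [Quandle T] [Finite T],
      (∀ D D' : Diagram, SameLink D D' →
        PhiSqp m n D T = PhiSqp m n D' T ∧ phiSqp m n D T = phiSqp m n D' T) ∧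
      (∀ D : Diagram,
        Multiset.card (PhiSqp m n D T) = Nat.card (D.Q →◃ T) ∧
        setQOne (phiSqp m n D T) = Nat.card (D.Q →◃ T))) ∧
    (∀ (T : Type u) [Biquandle T] [Finite T],
      (∀ D D' : Diagram, SameLink D D' →
        PhiSbp m n D T = PhiSbp m n D' T ∧ phiSbp m n D T = phiSbp m n D' T) ∧
      (∀ D : Diagram,
        Multiset.card (PhiSbp m n D T) = Nat.card (BiquandleHom D.B T) ∧
        setQOne (phiSbp m n D T) = Nat.card (BiquandleHom D.B T))) := by
  refine ⟨fun T _ _ => ⟨fun D D' h => ?_, fun D => ⟨card_values _, setQOne_powerSum _⟩⟩,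
    fun T _ _ => ⟨fun D D' h => ?_, fun D => ⟨card_values _, setQOne_powerSum _⟩⟩⟩
  · obtain ⟨e, he⟩ := h.exists_quandleHom_equiv T
    have hF : (fun f : D.Q →◃ T => sqp m n (Subquandle.image f)) =
        (fun f : D'.Q →◃ T => sqp m n (Subquandle.image f)) ∘ e :=
      funext fun f => sqp_congr m n (he f).symm
    rw [PhiSqp, phiSqp, hF]
    exact ⟨values_comp_equiv e _, powerSum_comp_equiv e _⟩
  · obtain ⟨e, he⟩ := h.exists_biquandleHom_equiv T
    have hF : (fun f : BiquandleHom D.B T => sbp m n (Subbiquandle.image f)) =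
        (fun f : BiquandleHom D'.B T => sbp m n (Subbiquandle.image f)) ∘ e :=
      funext fun f => sbp_congr m n (he f).symm
    rw [PhiSbp, phiSbp, hF]
    exact ⟨values_comp_equiv e _, powerSum_comp_equiv e _⟩
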